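/- **Setting.** Let $T\ge 0$, $\mathbb X=\mathbb R^n$, $\mathbb U=\mathbb R^m$ with Euclidean norms, and consider minimizing $\sum_{t=0}^{T-1}c_t(x_t,u_t)+\psi(x_T)$ subject to $x_t\in X_t$ $(0\le t\le T)$, $u_t\in U_t$, $x_{t+1}=f_t(x_t,u_t)$ $(0\le t\le T-1)$, with $x_0\in X_0$ given. Assume: each $X_t\subset\mathbb X$ is convex and compact with nonempty relative interior; each $U_t\subset\mathbb U$ is nonempty, convex and compact; $f_t(x,u)=A_tx+B_tu$ with matrices $A_t,B_t$; $c_t:\mathbb X\times\mathbb U\to\overline{\mathbb R}$ is proper, convex, lower semicontinuous and (finite and) Lipschitz on $X_t\times U_t$; $\psi:\mathbb X\to\overline{\mathbb R}$ is proper, convex, lower semicontinuous and (finite and) Lipschitz on $X_T$; and (relatively complete recourse) $f_t(x,U_t)\cap\mathrm{ri}(X_{t+1})\neq\emptyset$ for all $t<T$, $x\in X_t$. Let $\mathcal B_t(\phi)(x)=\inf_{u\in U_t}\big(c_t(x,u)+\phi(f_t(x,u))\big)$. For $S\subset\mathbb X$ let $\delta_S$ be $0$ on $S$ and $+\infty$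 elsewhere. The value functions, which include the state constraints, are $V_T=\psi+\delta_{X_T}$ and $V_t=\mathcal B_t(V_{t+1})+\delta_{X_t}$ for $t<T$; $\mathrm{dom}(V_t)=\{V_t<+\infty\}$. **SDDP selection.** Given constants $L_0,\dots,L_T\ge 0$, let $\mathbf F_t$ be the set of functions equal to an affine function $\langle a,\cdot\rangle+b$ with $\|a\|\le L_t$ on $X_t$ and to $+\infty$ elsewhere, and let $\overline{\mathbf F}_t$ be the set of proper convex functions of domain $X_t$ that are $L_t$-Lipschitz on $X_t$. An SDDP selection function $\phi^{\rm SDDP}$ for $(L_t)$ assigns an element of $\mathbf F_t$ to $(F,x)$ as follows. * For $t<T$, $F\subset\mathbf F_{t+1}$ finite and nonempty, and $x\in X_t$: let $b$ be the optimal value, attained at $(x,u,\lambda)$, of minimizing $c_t(x',u')+\lambda'$ over $(x',u',\lambda')\in X_t\times U_t\times\mathbb R$ subject to $x'=x$ and $\phi(f_t(x',u'))\le\lambda'$ for all $\phi\in F$. Let $a$, $\|a\|\le L_t$, be a Lagrange multiplier of $x'-x=0$: $(x,u,\lambda)$ minimizes $c_t(x',u')+\lambda'-\langle a,x'-x\rangle$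 over $(x',u',\lambda')\in X_t\times U_t\times\mathbb R$ satisfying the other constraints. Then $\phi_t^{\rm SDDP}(F,x)=\langle a,\cdot-x\rangle+b+\delta_{X_t}$. * For $t=T$, $F\subset\mathbf F_T$ finite and $x\in X_T$: $\phi_T^{\rm SDDP}(F,x)=\langle a,\cdot-x\rangle+V_T(x)+\delta_{X_T}$ with $a\in\partial V_T(x)$, $\|a\|\le L_T$. **Algorithm (Tropical Dynamic Programming).** Start from $F_t^0=\emptyset$, compact sets $K_t^0\subset\mathrm{dom}(V_t)$ and a probability measure $\mu^0$ carried by $K_0^0\times\dots\times K_T^0$. For $k\ge 0$, draw points $(x_0^k,\dots,x_T^k)$ at random: with law $\mu^0$ if $k=0$ and, if $k\ge1$, conditionally on the previous draws, according to the product of the uniform laws on $K_0^k,\dots,K_T^k$. Then set $F_T^{k+1}=F_T^k\cup\{\phi_T^{\rm SDDP}(F_T^k,x_T^k)\}$ and, for $t=T-1,\dots,0$, $F_t^{k+1}=F_t^k\cup\{\phi_t^{\rm SDDP}(F_{t+1}^{k+1},x_t^k)\}$. Let $V_t^k=\sup_{\phi\in F_t^k}\phi$ (so $V_t^0=-\infty$).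 For $k\ge1$ let $K_t^k=\{y_t^k\}$, where $(y_0^k,\dots,y_T^k)$ is an optimal trajectory for the $k$-th approximations starting from $x_0$: $y_0^k=x_0$ and, for $t<T$, $y_{t+1}^k=f_t(y_t^k,u_t^k)$ with $u_t^k\in\arg\min_{u\in U_t}\big(c_t(y_t^k,u)+V_{t+1}^k(f_t(y_t^k,u))\big)$. **Theorem.** 1. If moreover $f_t(x,\mathrm{ri}(U_t))\cap\mathrm{ri}(X_{t+1})\ne\emptyset$ for all $t<T$ and $x\in X_t$, then there are constants $(L_t)$ for which an SDDP selection function exists. 2. For all constants $(L_t)$, every SDDP selection function for $(L_t)$ and every run of the algorithm as above, the sequence $(V_t^k)_{k\in\mathbb N}$ is nondecreasing for every $t$, and almost surely over the draws, for every $t\in\{0,\dots,T\}$: $V_t^k\le V_t$ for all $k$; there is a function $V_t^*\in\overline{\mathbf F}_t$ such that $(V_t^k)_k$ converges uniformly to $V_t^*$ on every compact set included in $\mathrm{dom}(V_t)$; and $V_t^*=V_t$ on $\limsup_kK_t^k$, the set of limits of sequences $z_{\sigma(j)}\in K_t^{\sigma(j)}$ along strictly increasing $\sigma:\mathbb N\to\mathbb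 N$. -/

import Mathlib

open Filter Topology MeasureTheory ProbabilityTheory
open scoped NNReal

noncomputable section

namespace SDDP

/-- The Euclidean space `ℝ^n`. -/
abbrev Vec (n : ℕ) := EuclideanSpace ℝ (Fin n)

/-! ### Extended real valued functions -/

section ExtendedReal

variable {E : Type*}

/-- The effective domain `{f < +∞}`. -/
def dom (f : E → EReal) : Set E := {x | f x < ⊤}

/-- Proper: never `-∞` and not identically `+∞`. -/
def IsProper (f : E → EReal) : Prop := (∀ x, f x ≠ ⊥) ∧ ∃ x, f x ≠ ⊤

/-- Convexity of an extended real valued function: its epigraph is convex. -/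
def IsConvex [AddCommGroup E] [Module ℝ E] (f : E → EReal) : Prop :=
  Convex ℝ {p : E × ℝ | f p.1 ≤ (p.2 : EReal)}

/-- `f` is finite on `S` and `C`-Lipschitz there. -/
def IsLipschitzOn [PseudoEMetricSpace E] (C : ℝ≥0) (f : E → EReal) (S : Set E) : Prop :=
  ∃ g : E → ℝ, (∀ x ∈ S, f x = (g x : EReal)) ∧ LipschitzOnWith C g S

open Classical in
/-- `f + δ_S`: the function equal to `f` on `S` and to `+∞` elsewhere. -/
def restrictTo (S : Set E) (f : E → EReal) : E → EReal := fun x => if x ∈ S then f x else ⊤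

/-- Uniform convergence on `K` of extended real valued functions: the limit is finite on `K`,
the functions are finite on `K` from some index on, and these finite functions converge
uniformly on `K`. -/
def ConvergesUniformlyOn (f : ℕ → E → EReal) (g : E → EReal) (K : Set E) : Prop :=
  ∃ (f' : ℕ → E → ℝ) (g' : E → ℝ),
    (∀ᶠ k in atTop, ∀ x ∈ K, f k x = (f' k x : EReal)) ∧
    (∀ x ∈ K, g x = (g' x : EReal)) ∧ TendstoUniformlyOn f' g' atTop K

/-- The outer limit (Painlevé–Kuratowski `limsup`) of a sequence of sets: all cluster points of
sequences `y k ∈ K k`. -/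
def outerLimit [TopologicalSpace E] (K : ℕ → Set E) : Set E :=
  {x | ∃ (σ : ℕ → ℕ) (y : ℕ → E), StrictMono σ ∧ (∀ k, y k ∈ K (σ k)) ∧ Tendsto y atTop (𝓝 x)}

/-- The pointwise supremum of a set of functions (equal to `-∞` for the empty set). -/
def supOf (F : Set (E → EReal)) : E → EReal := fun x => ⨆ φ ∈ F, φ x

end ExtendedReal

/-! ### The multistage problem -/

/-- The data of a multistage problem with horizon `T`, states in `ℝ^n`, controls in `ℝ^m`:
state sets, control sets, matrices (as linear maps) of the dynamics, stage costs, final cost. -/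
structure Problem (n m T : ℕ) where
  X : Fin (T + 1) → Set (Vec n)
  U : Fin T → Set (Vec m)
  A : Fin T → Vec n →ₗ[ℝ] Vec n
  B : Fin T → Vec m →ₗ[ℝ] Vec n
  c : Fin T → Vec n → Vec m → EReal
  ψ : Vec n → EReal

namespace Problem

variable {n m T : ℕ} (P : Problem n m T)

/-- The dynamics `f_t(x, u) = A_t x + B_t u`. -/
def f (t : Fin T) (x : Vec n) (u : Vec m) : Vec n := P.A t x + P.B t u

/-- The linear-convex assumptions. -/
structure LinearConvex : Prop where
  convex_X : ∀ t, Convex ℝ (P.X t)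
  compact_X : ∀ t, IsCompact (P.X t)
  ri_X : ∀ t, (intrinsicInterior ℝ (P.X t)).Nonempty
  nonempty_U : ∀ t, (P.U t).Nonempty
  convex_U : ∀ t, Convex ℝ (P.U t)
  compact_U : ∀ t, IsCompact (P.U t)
  proper_c : ∀ t, IsProper (Function.uncurry (P.c t))
  convex_c : ∀ t, IsConvex (Function.uncurry (P.c t))
  lsc_c : ∀ t, LowerSemicontinuous (Function.uncurry (P.c t))
  lipschitz_c : ∀ t, ∃ C, IsLipschitzOn C (Function.uncurry (P.c t)) (P.X t.castSucc ×ˢ P.U t)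
  proper_ψ : IsProper P.ψ
  convex_ψ : IsConvex P.ψ
  lsc_ψ : LowerSemicontinuous P.ψ
  lipschitz_ψ : ∃ C, IsLipschitzOn C P.ψ (P.X (Fin.last T))
  /-- Relatively complete recourse. -/
  rcr : ∀ t, ∀ x ∈ P.X t.castSucc,
    (P.f t x '' P.U t ∩ intrinsicInterior ℝ (P.X t.succ)).Nonempty

/-- `c_t(x, u) + φ(f_t(x, u))`. -/
def bellmanAt (t : Fin T) (φ : Vec n → EReal) (x : Vec n) (u : Vec m) : EReal :=
  P.c t x u + φ (P.f t x u)

/-- The Bellman operator. -/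
def bellman (t : Fin T) (φ : Vec n → EReal) (x : Vec n) : EReal :=
  ⨅ u ∈ P.U t, P.bellmanAt t φ x u

/-- The value functions of the problem with the state constraints `x_t ∈ X_t`, by backward
recursion: `V_T = ψ + δ_{X_T}` and `V_t = B_t(V_{t+1}) + δ_{X_t}`. -/
def V : Fin (T + 1) → Vec n → EReal :=
  Fin.reverseInduction (motive := fun _ => Vec n → EReal)
    (restrictTo (P.X (Fin.last T)) P.ψ)
    (fun t W => restrictTo (P.X t.castSucc) (P.bellman t W))

/-! ### Basic functions and the SDDP selection function -/

/-- The function equal to the affine function `y ↦ ⟨a, y⟩ + b` on `X_t`, to `+∞` elsewhere. -/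
def affineOn (t : Fin (T + 1)) (a : Vec n) (b : ℝ) : Vec n → EReal :=
  restrictTo (P.X t) fun y => ((inner ℝ a y + b : ℝ) : EReal)

/-- The basic functions: affine on `X_t` with a slope of norm at most `L_t`, `+∞` elsewhere. -/
def basic (L : Fin (T + 1) → ℝ≥0) (t : Fin (T + 1)) : Set (Vec n → EReal) :=
  {φ | ∃ (a : Vec n) (b : ℝ), ‖a‖ ≤ L t ∧ φ = P.affineOn t a b}

/-- The proper convex functions of domain `X_t` that are `L_t`-Lipschitz on `X_t`. -/
def regular (L : Fin (T + 1) → ℝ≥0) (t : Fin (T + 1)) : Set (Vec n → EReal) :=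
  {φ | IsProper φ ∧ IsConvex φ ∧ dom φ = P.X t ∧ IsLipschitzOn (L t) φ (P.X t)}

/-- The triples `(x', u, r) ∈ X_t × U_t × ℝ` with `φ(f_t(x', u)) ≤ r` for all `φ ∈ F`. -/
def nodalSet (t : Fin T) (F : Set (Vec n → EReal)) : Set (Vec n × Vec m × ℝ) :=
  {p | p.1 ∈ P.X t.castSucc ∧ p.2.1 ∈ P.U t ∧ ∀ φ ∈ F, φ (P.f t p.1 p.2.1) ≤ (p.2.2 : EReal)}

/-- The objective `c_t(x', u) + r` of the nodal problem. -/
def nodalCost (t : Fin T) (p : Vec n × Vec m × ℝ) : EReal := P.c t p.1 p.2.1 + (p.2.2 : EReal)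

/-- The Lagrangian `c_t(x', u) + r - ⟨a, x' - x⟩`, where the constraint `x' = x` is dualized. -/
def lagrangian (t : Fin T) (x a : Vec n) (p : Vec n × Vec m × ℝ) : EReal :=
  P.nodalCost t p - ((inner ℝ a (p.1 - x) : ℝ) : EReal)

/-- `b` is the value of the nodal problem at `x` (minimize `nodalCost` over the points
`(x', u, r)` of `nodalSet` with `x' = x`), it is attained at `(x, u, r)`, and `a` is a Lagrange
multiplier of the constraint `x' - x = 0` there. The nodal problem is convex, so that stationarity
of the Lagrangian at `(x, u, r)` means minimality over `nodalSet`. -/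
structure IsNodalSolution (t : Fin T) (F : Set (Vec n → EReal)) (x : Vec n)
    (u : Vec m) (r : ℝ) (a : Vec n) (b : ℝ) : Prop where
  feasible : (x, u, r) ∈ P.nodalSet t F
  value : P.nodalCost t (x, u, r) = (b : EReal)
  optimal : ∀ p ∈ P.nodalSet t F, p.1 = x → (b : EReal) ≤ P.nodalCost t p
  stationary : IsMinOn (P.lagrangian t x a) (P.nodalSet t F) (x, u, r)

/-- `φ` is an SDDP cut at `x` for a time `t < T`: `y ↦ ⟨a, y - x⟩ + b` on `X_t`, where `b` is the
value of the nodal problem at `x` and `a` a multiplier, with `‖a‖ ≤ L_t`. -/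
def IsCut (L : Fin (T + 1) → ℝ≥0) (t : Fin T) (F : Set (Vec n → EReal)) (x : Vec n)
    (φ : Vec n → EReal) : Prop :=
  ∃ (u : Vec m) (r : ℝ) (a : Vec n) (b : ℝ), P.IsNodalSolution t F x u r a b ∧
    ‖a‖ ≤ L t.castSucc ∧
    φ = restrictTo (P.X t.castSucc) fun y => ((inner ℝ a (y - x) + b : ℝ) : EReal)

/-- `φ` is an SDDP cut at `x` for the time `T`: `y ↦ ⟨a, y - x⟩ + V_T(x)` on `X_T`, where
`a` is a subgradient of `V_T` at `x`, with `‖a‖ ≤ L_T`. -/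
def IsFinalCut (L : Fin (T + 1) → ℝ≥0) (x : Vec n) (φ : Vec n → EReal) : Prop :=
  ∃ a : Vec n,
    (∀ y, ((inner ℝ a (y - x) : ℝ) : EReal) + P.V (Fin.last T) x ≤ P.V (Fin.last T) y) ∧
    ‖a‖ ≤ L (Fin.last T) ∧
    φ = restrictTo (P.X (Fin.last T)) fun y =>
      ((inner ℝ a (y - x) : ℝ) : EReal) + P.V (Fin.last T) x

/-- `sel` is an SDDP selection function (with values in the basic functions given by `L`). Only
nonempty finite sets `F` of basic functions occur in the algorithm for `t < T`; for `F = ∅` the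
nodal problem is unbounded. -/
structure IsSelection (L : Fin (T + 1) → ℝ≥0)
    (sel : Fin (T + 1) → Set (Vec n → EReal) → Vec n → Vec n → EReal) : Prop where
  stage : ∀ (t : Fin T) (F : Set (Vec n → EReal)), F ⊆ P.basic L t.succ → F.Finite → F.Nonempty →
    ∀ x ∈ P.X t.castSucc, P.IsCut L t F x (sel t.castSucc F x)
  final : ∀ (F : Set (Vec n → EReal)), F ⊆ P.basic L (Fin.last T) → F.Finite →
    ∀ x ∈ P.X (Fin.last T), P.IsFinalCut L x (sel (Fin.last T) F x)

/-- The recourse condition with controls in the relative interior of `U_t` (it follows from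
`rcr` when each `X_{t+1}` has nonempty interior). -/
def StrictRecourse : Prop :=
  ∀ t : Fin T, ∀ x ∈ P.X t.castSucc,
    (P.f t x '' intrinsicInterior ℝ (P.U t) ∩ intrinsicInterior ℝ (P.X t.succ)).Nonempty

/-- `x` is an optimal trajectory starting from `x₀` for the approximations `W` of the value
functions: `x_{t+1} = f_t(x_t, u_t)` where `u_t` minimizes `c_t(x_t, ·) + W_{t+1}(f_t(x_t, ·))`
over `U_t`. -/
def IsOptimalTrajectory (W : Fin (T + 1) → Vec n → EReal) (x₀ : Vec n)
    (x : Fin (T + 1) → Vec n) : Prop :=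
  x 0 = x₀ ∧ ∀ t : Fin T, ∃ u ∈ P.U t,
    IsMinOn (P.bellmanAt t (W t.succ) (x t.castSucc)) (P.U t) u ∧
    x t.succ = P.f t (x t.castSucc) u

end Problem

/-! ### Tropical Dynamic Programming -/

section TDP

variable {n T : ℕ}

/-- The sets `F_t^k` built by Tropical Dynamic Programming from the draws `x k t = x_t^k`:
`F_t^0 = ∅`; at iteration `k + 1`, first `F_T^{k+1} = F_T^k ∪ {sel_T(F_T^k, x_T^k)}`, then
`F_t^{k+1} = F_t^k ∪ {sel_t(F_{t+1}^{k+1}, x_t^k)}` for `t` from `T - 1` down to `0`. -/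
def tdpSets (sel : Fin (T + 1) → Set (Vec n → EReal) → Vec n → Vec n → EReal)
    (x : ℕ → Fin (T + 1) → Vec n) : ℕ → Fin (T + 1) → Set (Vec n → EReal)
  | 0 => fun _ => ∅
  | k + 1 => Fin.reverseInduction (motive := fun _ => Set (Vec n → EReal))
      (tdpSets sel x k (Fin.last T) ∪
        {sel (Fin.last T) (tdpSets sel x k (Fin.last T)) (x k (Fin.last T))})
      (fun t G => tdpSets sel x k t.castSucc ∪ {sel t.castSucc G (x k t.castSucc)})

/-- The approximations `V_t^k`, the pointwise supremum of `F_t^k`. -/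
def approx (sel : Fin (T + 1) → Set (Vec n → EReal) → Vec n → Vec n → EReal)
    (x : ℕ → Fin (T + 1) → Vec n) (k : ℕ) (t : Fin (T + 1)) : Vec n → EReal :=
  supOf (tdpSets sel x k t)

/-- The sets `K_t^k` of one run: the initial sets for `k = 0`, then the singletons `{x_t^k}` of
the trajectories. -/
def trialSets (K₀ : Fin (T + 1) → Set (Vec n)) (traj : ℕ → Fin (T + 1) → Vec n) :
    ℕ → Fin (T + 1) → Set (Vec n)
  | 0 => K₀
  | k + 1 => fun t => {traj (k + 1) t}

/-- `draw k` are the random points of Tropical Dynamic Programming: the points of the first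
iteration have the law `μ₀`; given all previous draws, the points `(draw (k + 1) · t)_t` are
independent and uniform over the sets `K (k + 1) · t`. -/
structure IsDraws {Ω : Type*} [MeasurableSpace Ω] (Pr : Measure Ω)
    (μ₀ : Measure (Fin (T + 1) → Vec n)) (K : ℕ → Ω → Fin (T + 1) → Set (Vec n))
    (draw : ℕ → Ω → Fin (T + 1) → Vec n) : Prop where
  measurable : ∀ k, Measurable (draw k)
  law_zero : Pr.map (draw 0) = μ₀
  law_succ : ∀ (k : ℕ) (S : Set (Fin (T + 1) → Vec n)), MeasurableSet S →
    Pr⟦draw (k + 1) ⁻¹' S |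
        MeasurableSpace.comap (fun ω (j : Fin (k + 1)) => draw j ω) MeasurableSpace.pi⟧
      =ᵐ[Pr] fun ω => (Measure.pi fun t => uniformOn (K (k + 1) ω t)).real S

end TDP

end SDDP

end

open Filter Topology MeasureTheory ProbabilityTheory
open scoped NNReal

noncomputable section

namespace SDDP

/-! Existence of a selection is a matter of bounding multipliers. A multiplier at `x` is a
subgradient of the stage value function, and a convex function that is `C`-Lipschitz on its domain
has a subgradient of norm at most `C` at every point (`exists_subgradient_of_lipschitzOnWith`). The
value function is Lipschitz because feasible controls can be followed at Lipschitz cost when the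
state moves (`exists_lipschitz_recourse`); this is where the strict recourse condition enters. The
constant at time `t` depends only on the one at `t + 1`, so the `L t` are built backwards.

For convergence, every cut lies below the value function by weak duality (`LinearConvex.cut_le`).
The approximations increase, are bounded above and share the Lipschitz constant `L t`, so they
converge uniformly by Dini. All later trial points are almost surely the optimal trajectories, since
their conditional law is a Dirac mass (`IsDraws.ae_eq_traj`). At such a point the new approximation
at `t` dominates stage cost plus the old approximation at `t + 1`, taken at the next point of the
trajectory (`LinearConvex.bellmanAt_le_approx`). Passing to the limit along a subsequence where
trajectories and controls converge, old and new approximations have the same limit, and backward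
induction from the exact final cut gives equality with the value functions
(`LinearConvex.limit_eq_of_tendsto`). -/

/-- The Lipschitz bound puts the graph of `g` above the downward cone of slope `C` with apex `(x, g
x)`. A hyperplane separating the epigraph from the open region under the cone is the graph of an
affine minorant of `g`; lying above the cone bounds its slope by `C`. -/
theorem exists_subgradient_of_lipschitzOnWith {E : Type*} [NormedAddCommGroup E]
    [InnerProductSpace ℝ E] [CompleteSpace E] {S : Set E} {g : E → ℝ} {C : ℝ≥0}
    (hg : ConvexOn ℝ S g) (hL : LipschitzOnWith C g S) {x : E} (hx : x ∈ S) :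
    ∃ a : E, ‖a‖ ≤ C ∧ ∀ y ∈ S, g x + inner ℝ a (y - x) ≤ g y := by
  have hlow : ConvexOn ℝ Set.univ fun y : E => C * ‖y - x‖ := by
    have h := (convexOn_univ_norm (E := E)).translate_left (-x)
    simp only [Set.preimage_univ] at h
    have h2 := h.smul C.2
    simpa [sub_eq_add_neg, Function.comp_def, NNReal.smul_def] using h2
  have hB : Convex ℝ {p : E × ℝ | p.1 ∈ Set.univ ∧ p.2 < g x - C * ‖p.1 - x‖} := by
    have := (concaveOn_const (g x) (convex_univ (𝕜 := ℝ) (E := E))).sub hlow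
    exact this.convex_strict_hypograph
  have hBo : IsOpen {p : E × ℝ | p.1 ∈ Set.univ ∧ p.2 < g x - C * ‖p.1 - x‖} := by
    simp only [Set.mem_univ, true_and]
    exact isOpen_lt (by fun_prop) (by fun_prop)
  have hdis : Disjoint {p : E × ℝ | p.1 ∈ Set.univ ∧ p.2 < g x - C * ‖p.1 - x‖}
      {p : E × ℝ | p.1 ∈ S ∧ g p.1 ≤ p.2} := by
    rw [Set.disjoint_left]
    rintro ⟨y, r⟩ ⟨-, h1⟩ ⟨hy, h2⟩
    have := hL.dist_le_mul y hy x hx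
    rw [Real.dist_eq, dist_eq_norm] at this
    have := abs_le.1 this
    simp only at h1 h2 hy
    linarith
  obtain ⟨f, s, hf1, hf2⟩ := geometric_hahn_banach_open hB hBo hg.convex_epigraph hdis
  set α := f (0, 1)
  have hf : ∀ y r, f (y, r) = f (y, 0) + r * α := by
    intro y r
    have : ((y, r) : E × ℝ) = (y, 0) + r • (0, 1) := by simp
    rw [this, map_add, map_smul, smul_eq_mul]
  have h1 : ∀ y r, r < g x - C * ‖y - x‖ → f (y, 0) + r * α < s := fun y r h => by
    rw [← hf]; exact hf1 _ ⟨Set.mem_univ _, h⟩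
  have h2 : ∀ y ∈ S, s ≤ f (y, 0) + g y * α := fun y h => by
    rw [← hf]; exact hf2 _ ⟨h, le_rfl⟩
  -- The separating hyperplane is not vertical: compare two points above `x`, one in each set.
  have hα : 0 < α := by
    have e1 := h1 x (g x - 1) (by simp)
    have e2 := h2 x hx
    nlinarith
  have h1' : ∀ y, f (y, 0) + (g x - C * ‖y - x‖) * α ≤ s := by
    intro y
    refine le_of_forall_pos_lt_add fun ε hε => ?_
    have := h1 y (g x - C * ‖y - x‖ - ε / α) (by have := div_pos hε hα; linarith)
    have e : ε / α * α = ε := div_mul_cancel₀ _ hα.ne'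
    linarith [sub_mul (g x - C * ‖y - x‖) (ε / α) α]
  have hs : s = f (x, 0) + g x * α :=
    le_antisymm (h2 x hx) (by simpa using h1' x)
  let ℓ : StrongDual ℝ E := f.comp (ContinuousLinearMap.inl ℝ E ℝ)
  have hℓ : ∀ v, f (v, 0) = ℓ v := fun v => by simp [ℓ]
  simp only [hℓ] at h1' h2 hs
  refine ⟨-(α⁻¹ • (InnerProductSpace.toDual ℝ E).symm ℓ), ?_, fun y hy => ?_⟩
  -- Testing the cone inequality at `x + v` and `x - v` bounds `ℓ v` on both sides.
  · rw [norm_neg, norm_smul, LinearIsometryEquiv.norm_map, Real.norm_eq_abs,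
      abs_of_pos (inv_pos.2 hα), inv_mul_le_iff₀ hα]
    refine ContinuousLinearMap.opNorm_le_bound _ (by positivity) fun v => ?_
    rw [Real.norm_eq_abs, abs_le]
    have e1 := h1' (x + v)
    have e2 := h1' (x + -v)
    simp only [add_sub_cancel_left, map_add, map_neg, norm_neg] at e1 e2
    constructor <;> nlinarith
  · have := h2 y hy
    rw [inner_neg_left, real_inner_smul_left, InnerProductSpace.toDual_symm_apply, map_sub]
    have e : α⁻¹ * (ℓ y - ℓ x) = (ℓ y - ℓ x) / α := by field_simp
    rw [e]
    have e3 : g x - g y ≤ (ℓ y - ℓ x) / α := by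
      rw [le_div_iff₀ hα]; nlinarith
    linarith

theorem exists_ball_inter_affineSpan_subset {E : Type*} [NormedAddCommGroup E] [NormedSpace ℝ E]
    {s : Set E} {x : E} (hx : x ∈ intrinsicInterior ℝ s) :
    ∃ ρ > 0, ∀ y ∈ affineSpan ℝ s, ‖y - x‖ ≤ ρ → y ∈ s := by
  obtain ⟨z, hz, rfl⟩ := mem_intrinsicInterior.1 hx
  obtain ⟨ρ, hρ, hb⟩ := Metric.nhds_basis_closedBall.mem_iff.1 (mem_interior_iff_mem_nhds.1 hz)
  refine ⟨ρ, hρ, fun y hy h => ?_⟩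
  have : (⟨y, hy⟩ : affineSpan ℝ s) ∈ Metric.closedBall z ρ := by
    rw [Metric.mem_closedBall, Subtype.dist_eq, dist_eq_norm]; exact h
  exact hb this

theorem add_mem_affineSpan_of_mem_vectorSpan {E : Type*} [NormedAddCommGroup E]
    [NormedSpace ℝ E] {s : Set E} {y p : E} (hy : y ∈ s) (hp : p ∈ vectorSpan ℝ s) :
    y + p ∈ affineSpan ℝ s := by
  rw [add_comm]
  exact vadd_mem_affineSpan_of_mem_affineSpan_of_mem_vectorSpan (subset_affineSpan ℝ s hy) hp

/-! ### Lipschitz stability of feasible controls -/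

section Recourse

variable {E F G : Type*} [NormedAddCommGroup E] [NormedSpace ℝ E] [FiniteDimensional ℝ E]
  [NormedAddCommGroup F] [NormedSpace ℝ F] [FiniteDimensional ℝ F]
  [NormedAddCommGroup G] [NormedSpace ℝ G] [FiniteDimensional ℝ G]

/-- The admissible pairs `(h, p)` form a subspace; its projection to `h` has a linear section over
its range, which is bounded in finite dimension. -/
theorem exists_bounded_correction (A : E →ₗ[ℝ] G) (B : F →ₗ[ℝ] G) (D : Submodule ℝ F)
    (D' : Submodule ℝ G) : ∃ M > 0, ∀ h : E, (∃ p ∈ D, A h + B p ∈ D') →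
      ∃ p ∈ D, A h + B p ∈ D' ∧ ‖p‖ ≤ M * ‖h‖ ∧ ‖A h + B p‖ ≤ M * ‖h‖ := by
  let W : Submodule ℝ (E × F) :=
    D.comap (LinearMap.snd ℝ E F) ⊓ D'.comap (A.coprod B)
  let π : W →ₗ[ℝ] E := LinearMap.fst ℝ E F ∘ₗ W.subtype
  obtain ⟨s, hs⟩ := π.rangeRestrict.exists_rightInverse_of_surjective π.range_rangeRestrict
  let s₁ := (LinearMap.snd ℝ E F ∘ₗ W.subtype ∘ₗ s).toContinuousLinearMap
  let s₂ := (A.coprod B ∘ₗ W.subtype ∘ₗ s).toContinuousLinearMap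
  refine ⟨max ‖s₁‖ ‖s₂‖ + 1, by positivity, ?_⟩
  rintro h ⟨p, hp, hp'⟩
  let h' : LinearMap.range π := ⟨h, ⟨⟨(h, p), hp, by simpa using hp'⟩, rfl⟩⟩
  have hh : ((s h' : E × F)).1 = h := by
    have := congrArg Subtype.val (LinearMap.congr_fun hs h')
    exact this
  have e : A h + B (s h' : E × F).2 = A.coprod B (s h' : E × F) := by
    rw [LinearMap.coprod_apply, hh]
  refine ⟨(s h' : E × F).2, (s h').2.1, ?_, ?_, ?_⟩
  · rw [e]; exact (s h').2.2
  · refine (s₁.le_opNorm h').trans ?_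
    have : ‖h'‖ = ‖h‖ := rfl
    rw [this]
    gcongr
    linarith [le_max_left ‖s₁‖ ‖s₂‖]
  · rw [e]
    refine (s₂.le_opNorm h').trans ?_
    have : ‖h'‖ = ‖h‖ := rfl
    rw [this]
    gcongr
    linarith [le_max_right ‖s₁‖ ‖s₂‖]

/-- A linear correction `p` restores only the affine hull constraints. Mixing with a Slater control
at `x'`, with weight of order `‖x' - x‖`, restores membership in `U` and `Y`. -/
theorem exists_lipschitz_recourse {X : Set E} {U : Set F} {Y : Set G} (hX : IsCompact X)
    (hUb : Bornology.IsBounded U) (hU : Convex ℝ U) (hY : Convex ℝ Y)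
    (A : E →ₗ[ℝ] G) (B : F →ₗ[ℝ] G)
    (h : ∀ x ∈ X, ∃ u ∈ intrinsicInterior ℝ U, A x + B u ∈ intrinsicInterior ℝ Y) :
    ∃ K : ℝ≥0, ∀ x ∈ X, ∀ x' ∈ X, ∀ u ∈ U, A x + B u ∈ Y →
      ∃ u' ∈ U, A x' + B u' ∈ Y ∧ ‖u' - u‖ ≤ K * ‖x' - x‖ := by
  obtain ⟨M, hM, hcor⟩ := exists_bounded_correction A B (vectorSpan ℝ U) (vectorSpan ℝ Y)
  have hcor' : ∀ x ∈ X, ∀ x' ∈ X, ∃ p ∈ vectorSpan ℝ U, A (x' - x) + B p ∈ vectorSpan ℝ Y ∧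
      ‖p‖ ≤ M * ‖x' - x‖ ∧ ‖A (x' - x) + B p‖ ≤ M * ‖x' - x‖ := by
    intro x hx x' hx'
    apply hcor
    obtain ⟨u, hu, hu'⟩ := h x hx
    obtain ⟨v, hv, hv'⟩ := h x' hx'
    refine ⟨v - u, vsub_mem_vectorSpan ℝ (intrinsicInterior_subset hv)
      (intrinsicInterior_subset hu), ?_⟩
    have := vsub_mem_vectorSpan ℝ (intrinsicInterior_subset hv') (intrinsicInterior_subset hu')
    rw [vsub_eq_sub] at this
    convert this using 1
    simp only [map_sub]; abel
  -- Slater controls with a slack `ρ` uniform in `x`, by compactness: near `x`, the corrected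
  -- control `u + p` keeps half of the slack available at `x`.
  have hslack : ∃ ρ > 0, ∀ x ∈ X, ∃ u ∈ U, A x + B u ∈ Y ∧
      (∀ v ∈ affineSpan ℝ U, ‖v - u‖ ≤ ρ → v ∈ U) ∧
      ∀ y ∈ affineSpan ℝ Y, ‖y - (A x + B u)‖ ≤ ρ → y ∈ Y := by
    refine hX.induction_on (p := fun S => ∃ ρ > 0, ∀ x ∈ S, ∃ u ∈ U, A x + B u ∈ Y ∧
      (∀ v ∈ affineSpan ℝ U, ‖v - u‖ ≤ ρ → v ∈ U) ∧
      ∀ y ∈ affineSpan ℝ Y, ‖y - (A x + B u)‖ ≤ ρ → y ∈ Y) ⟨1, one_pos, by simp⟩ ?_ ?_ ?_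
    · rintro s t hst ⟨ρ, hρ, H⟩
      exact ⟨ρ, hρ, fun x hx => H x (hst hx)⟩
    · rintro s t ⟨ρ, hρ, H⟩ ⟨ρ', hρ', H'⟩
      refine ⟨min ρ ρ', lt_min hρ hρ', fun x hx => ?_⟩
      rcases hx with hx | hx
      · obtain ⟨u, h1, h2, h3, h4⟩ := H x hx
        exact ⟨u, h1, h2, fun v hv hn => h3 v hv (hn.trans (min_le_left _ _)),
          fun v hv hn => h4 v hv (hn.trans (min_le_left _ _))⟩
      · obtain ⟨u, h1, h2, h3, h4⟩ := H' x hx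
        exact ⟨u, h1, h2, fun v hv hn => h3 v hv (hn.trans (min_le_right _ _)),
          fun v hv hn => h4 v hv (hn.trans (min_le_right _ _))⟩
    · intro x hx
      obtain ⟨u, hu, hu'⟩ := h x hx
      obtain ⟨ρ₁, hρ₁, H₁⟩ := exists_ball_inter_affineSpan_subset hu
      obtain ⟨ρ₂, hρ₂, H₂⟩ := exists_ball_inter_affineSpan_subset hu'
      obtain ⟨ρ, hρ, hle₁, hle₂⟩ : ∃ ρ > 0, ρ ≤ ρ₁ ∧ ρ ≤ ρ₂ :=
        ⟨min ρ₁ ρ₂, lt_min hρ₁ hρ₂, min_le_left _ _, min_le_right _ _⟩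
      refine ⟨X ∩ Metric.ball x (ρ / 2 / M), inter_mem_nhdsWithin _
        (Metric.ball_mem_nhds x (by positivity)), ρ / 2, by positivity, ?_⟩
      rintro x' ⟨hx', hd⟩
      obtain ⟨p, hp, hp', hn, hn'⟩ := hcor' x hx x' hx'
      rw [Metric.mem_ball, dist_eq_norm, lt_div_iff₀ hM, mul_comm] at hd
      have e : A x' + B (u + p) = A x + B u + (A (x' - x) + B p) := by
        simp only [map_sub, map_add]; abel
      refine ⟨u + p, H₁ _
        (add_mem_affineSpan_of_mem_vectorSpan (intrinsicInterior_subset hu) hp) ?_, ?_, ?_, ?_⟩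
      · rw [add_sub_cancel_left]; linarith
      · rw [e]
        refine H₂ _ (add_mem_affineSpan_of_mem_vectorSpan (intrinsicInterior_subset hu') hp') ?_
        rw [add_sub_cancel_left]; linarith
      · intro v hv hvn
        refine H₁ v hv ?_
        have : v - u = (v - (u + p)) + p := by abel
        rw [this]
        exact (norm_add_le _ _).trans (by linarith)
      · intro y hy hyn
        refine H₂ y hy ?_
        have : y - (A x + B u) = (y - (A x' + B (u + p))) + (A (x' - x) + B p) := by
          rw [e]; abel
        rw [this]
        exact (norm_add_le _ _).trans (by linarith)
  obtain ⟨ρ, hρ, hs⟩ := hslack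
  obtain ⟨R, hR⟩ := hUb.exists_norm_le
  refine ⟨Real.toNNReal (M + M / ρ * (2 * R)), fun x hx x' hx' u hu hxu => ?_⟩
  rcases eq_or_ne x x' with rfl | hne
  · exact ⟨u, hu, hxu, by simp⟩
  obtain ⟨p, hp, hp', hn, hn'⟩ := hcor' x hx x' hx'
  obtain ⟨v, hv, hv', hvU, hvY⟩ := hs x' hx'
  have hd : 0 < ‖x' - x‖ := norm_pos_iff.2 (sub_ne_zero.2 hne.symm)
  set d := ‖x' - x‖
  have hden : 0 < ρ + M * d := by positivity
  -- This weight makes `(1 - l) / l` times the bound `M * d` on the corrections exactly `ρ`, the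
  -- slack available at `v`.
  set l := M * d / (ρ + M * d) with hl
  have hl0 : 0 < l := by positivity
  have hl1 : 1 - l = ρ / (ρ + M * d) := by rw [hl]; field_simp; ring
  have hl1' : 0 < 1 - l := by rw [hl1]; positivity
  have hq : (1 - l) / l * (M * d) = ρ := by rw [hl1, hl]; field_simp
  have hq0 : 0 < (1 - l) / l := by positivity
  have hmul : l * ((1 - l) / l) = 1 - l := by field_simp
  have hw : v + ((1 - l) / l) • p ∈ U := by
    refine hvU _ (add_mem_affineSpan_of_mem_vectorSpan hv (Submodule.smul_mem _ _ hp)) ?_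
    rw [add_sub_cancel_left, norm_smul, Real.norm_eq_abs, abs_of_pos hq0, ← hq]
    gcongr
  have hz : A x' + B v + ((1 - l) / l) • (A (x' - x) + B p) ∈ Y := by
    refine hvY _ (add_mem_affineSpan_of_mem_vectorSpan hv' (Submodule.smul_mem _ _ hp')) ?_
    rw [add_sub_cancel_left, norm_smul, Real.norm_eq_abs, abs_of_pos hq0, ← hq]
    gcongr
  -- This is `(1 - l) • (u + p) + l • v`, regrouped because `u + p` may leave `U`: the correction is
  -- charged to `v`, which has slack.
  refine ⟨(1 - l) • u + l • (v + ((1 - l) / l) • p),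
    hU hu hw hl1'.le hl0.le (by ring), ?_, ?_⟩
  · have := hY hxu hz hl1'.le hl0.le (by ring)
    convert this using 1
    simp only [map_add, map_smul, map_sub, smul_add, smul_smul, hmul, smul_sub]
    module
  · have e : (1 - l) • u + l • (v + ((1 - l) / l) • p) - u = (1 - l) • p + l • (v - u) := by
      rw [smul_add, smul_smul, hmul]; module
    have hl2 : l ≤ M / ρ * d := by
      rw [hl, div_mul_eq_mul_div]
      exact div_le_div_of_nonneg_left (by positivity) hρ (by nlinarith)
    have hvu : ‖v - u‖ ≤ 2 * R := (norm_sub_le _ _).trans (by linarith [hR v hv, hR u hu])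
    rw [e]
    calc ‖(1 - l) • p + l • (v - u)‖ ≤ (1 - l) * ‖p‖ + l * ‖v - u‖ := by
          refine (norm_add_le _ _).trans ?_
          rw [norm_smul, norm_smul, Real.norm_eq_abs, Real.norm_eq_abs, abs_of_pos hl0,
            abs_of_pos hl1']
      _ ≤ 1 * (M * d) + M / ρ * d * (2 * R) := by
          gcongr
          linarith
      _ = (M + M / ρ * (2 * R)) * d := by ring
      _ ≤ _ := by gcongr; exact Real.le_coe_toNNReal _

end Recourse

/-! ### From extended real valued to real valued functions -/

theorem IsConvex.convexOn {E : Type*} [AddCommGroup E] [Module ℝ E] {f : E → EReal}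
    (hf : IsConvex f) {S : Set E} (hS : Convex ℝ S) {g : E → ℝ} (hg : ∀ x ∈ S, f x = (g x : EReal)) :
    ConvexOn ℝ S g := by
  refine ⟨hS, fun x hx y hy a b ha hb hab => ?_⟩
  have hx' : (x, g x) ∈ {p : E × ℝ | f p.1 ≤ (p.2 : EReal)} := (hg x hx).le
  have hy' : (y, g y) ∈ {p : E × ℝ | f p.1 ≤ (p.2 : EReal)} := (hg y hy).le
  have h : f (a • x + b • y) ≤ ((a • g x + b • g y : ℝ) : EReal) := hf hx' hy' ha hb hab
  rw [hg _ (hS hx hy ha hb hab)] at h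
  exact_mod_cast h

theorem restrictTo_of_mem {E : Type*} {S : Set E} {f : E → EReal} {x : E} (hx : x ∈ S) :
    restrictTo S f x = f x := if_pos hx

theorem restrictTo_of_notMem {E : Type*} {S : Set E} {f : E → EReal} {x : E} (hx : x ∉ S) :
    restrictTo S f x = ⊤ := if_neg hx

theorem restrictTo_coe_le_coe {E : Type*} {S : Set E} {g : E → ℝ} {x : E} {r : ℝ} :
    restrictTo S (fun y => (g y : EReal)) x ≤ (r : EReal) ↔ x ∈ S ∧ g x ≤ r := by
  by_cases hx : x ∈ S
  · simp [restrictTo_of_mem hx, hx]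
  · simp [restrictTo_of_notMem hx, hx]

theorem restrictTo_congr {E : Type*} {S : Set E} {f g : E → EReal} (h : ∀ x ∈ S, f x = g x) :
    restrictTo S f = restrictTo S g := by
  funext x
  by_cases hx : x ∈ S
  · rw [restrictTo_of_mem hx, restrictTo_of_mem hx, h x hx]
  · rw [restrictTo_of_notMem hx, restrictTo_of_notMem hx]

namespace Problem

variable {n m T : ℕ} {P : Problem n m T}

theorem V_last : P.V (Fin.last T) = restrictTo (P.X (Fin.last T)) P.ψ := by
  rw [V, Fin.reverseInduction_last]

theorem V_castSucc (t : Fin T) :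
    P.V t.castSucc = restrictTo (P.X t.castSucc) (P.bellman t (P.V t.succ)) := by
  rw [V, Fin.reverseInduction_castSucc]

theorem f_combo (t : Fin T) (x y : Vec n) (u v : Vec m) (a b : ℝ) :
    P.f t (a • x + b • y) (a • u + b • v) = a • P.f t x u + b • P.f t y v := by
  simp only [f, map_add, map_smul, smul_add]; abel

theorem continuous_f (t : Fin T) : Continuous fun p : Vec n × Vec m => P.f t p.1 p.2 :=
  ((P.A t).continuous_of_finiteDimensional.comp continuous_fst).add
    ((P.B t).continuous_of_finiteDimensional.comp continuous_snd)

theorem LinearConvex.exists_stageCost (hP : P.LinearConvex) (t : Fin T) :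
    ∃ (γ : Vec n × Vec m → ℝ) (C : ℝ≥0),
      (∀ x ∈ P.X t.castSucc, ∀ u ∈ P.U t, P.c t x u = (γ (x, u) : EReal)) ∧
      LipschitzOnWith C γ (P.X t.castSucc ×ˢ P.U t) ∧
      ConvexOn ℝ (P.X t.castSucc ×ˢ P.U t) γ := by
  obtain ⟨C, γ, h1, h2⟩ := hP.lipschitz_c t
  exact ⟨γ, C, fun x hx u hu => h1 (x, u) ⟨hx, hu⟩, h2,
    (hP.convex_c t).convexOn ((hP.convex_X _).prod (hP.convex_U t)) h1⟩

/-- A finite supremum of basic functions is, on `X_t`, a Lipschitz convex function. -/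
theorem exists_supOf_basic {L : Fin (T + 1) → ℝ≥0} {t : Fin (T + 1)} {F : Set (Vec n → EReal)}
    (hF : F ⊆ P.basic L t) (hfin : F.Finite) (hne : F.Nonempty) :
    ∃ w : Vec n → ℝ, LipschitzWith (L t) w ∧ ConvexOn ℝ Set.univ w ∧
      supOf F = restrictTo (P.X t) fun y => (w y : EReal) := by
  induction F, hfin using Set.Finite.induction_on with
  | empty => exact absurd hne Set.not_nonempty_empty
  | @insert φ s _ _ ih =>
    obtain ⟨a, b, ha, rfl⟩ := hF (Set.mem_insert _ _)
    have haff : LipschitzWith (L t) fun y : Vec n => inner ℝ a y + b := by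
      refine LipschitzWith.of_dist_le_mul fun x y => ?_
      rw [Real.dist_eq, dist_eq_norm, add_sub_add_right_eq_sub, ← inner_sub_right]
      exact (abs_real_inner_le_norm _ _).trans (by gcongr)
    have hcvx : ConvexOn ℝ Set.univ fun y : Vec n => inner ℝ a y + b :=
      ((innerSL ℝ a).toLinearMap.convexOn convex_univ).add_const b
    rcases s.eq_empty_or_nonempty with rfl | hs
    · refine ⟨_, haff, hcvx, ?_⟩
      funext y
      simp [supOf, affineOn]
    · obtain ⟨w, hw, hwc, hsup⟩ := ih ((Set.subset_insert _ _).trans hF) hs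
      refine ⟨fun y => max (inner ℝ a y + b) (w y), by simpa using haff.max hw,
        hcvx.sup hwc, ?_⟩
      funext y
      have e : supOf (insert (P.affineOn t a b) s) y = P.affineOn t a b y ⊔ supOf s y := by
        simp only [supOf, iSup_insert]
      rw [e, hsup]
      by_cases hy : y ∈ P.X t
      · simp only [affineOn, restrictTo_of_mem hy]
        exact ((EReal.coe_strictMono.monotone).map_max).symm
      · simp only [affineOn, restrictTo_of_notMem hy, sup_idem]

theorem le_iff_supOf_le {F : Set (Vec n → EReal)} {y : Vec n} {r : EReal} :
    (∀ φ ∈ F, φ y ≤ r) ↔ supOf F y ≤ r := by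
  simp [supOf]

theorem mem_nodalSet_iff {t : Fin T} {F : Set (Vec n → EReal)} {w : Vec n → ℝ}
    (hw : supOf F = restrictTo (P.X t.succ) fun y => (w y : EReal)) {x : Vec n} {u : Vec m} {r : ℝ} :
    (x, u, r) ∈ P.nodalSet t F ↔
      x ∈ P.X t.castSucc ∧ u ∈ P.U t ∧ P.f t x u ∈ P.X t.succ ∧ w (P.f t x u) ≤ r := by
  simp only [nodalSet, Set.mem_ofPred_eq, le_iff_supOf_le, hw, restrictTo_coe_le_coe]

/-! ### The value function of one stage -/

section Stage

variable (P) in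
/-- The controls which are feasible at `x`. -/
def feasible (t : Fin T) (x : Vec n) : Set (Vec m) := {u ∈ P.U t | P.f t x u ∈ P.X t.succ}

theorem LinearConvex.isCompact_feasible (hP : P.LinearConvex) (t : Fin T) (x : Vec n) :
    IsCompact (P.feasible t x) := by
  refine (hP.compact_U t).inter_right ((hP.compact_X t.succ).isClosed.preimage ?_)
  exact (continuous_f t).comp (by fun_prop : Continuous fun u : Vec m => (x, u))

theorem LinearConvex.feasible_nonempty (hP : P.LinearConvex) (t : Fin T) {x : Vec n}
    (hx : x ∈ P.X t.castSucc) : (P.feasible t x).Nonempty := by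
  obtain ⟨_, ⟨u, hu, rfl⟩, h⟩ := hP.rcr t x hx
  exact ⟨u, hu, intrinsicInterior_subset h⟩

variable {t : Fin T} {γ : Vec n × Vec m → ℝ} {w : Vec n → ℝ} {C ℓ : ℝ≥0}

theorem LinearConvex.exists_minimizer (hP : P.LinearConvex)
    (hγ : LipschitzOnWith C γ (P.X t.castSucc ×ˢ P.U t)) (hw : LipschitzWith ℓ w) {x : Vec n}
    (hx : x ∈ P.X t.castSucc) :
    ∃ u ∈ P.feasible t x, ∀ u' ∈ P.feasible t x,
      γ (x, u) + w (P.f t x u) ≤ γ (x, u') + w (P.f t x u') := by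
  refine (hP.isCompact_feasible t x).exists_isMinOn (hP.feasible_nonempty t hx)
    (f := fun u => γ (x, u) + w (P.f t x u)) (ContinuousOn.add ?_ ?_)
  · exact hγ.continuousOn.comp (by fun_prop) fun u hu => ⟨hx, hu.1⟩
  · exact (hw.continuous.comp ((continuous_f t).comp
      (by fun_prop : Continuous fun u : Vec m => (x, u)))).continuousOn

/-- Partial minimization of a jointly convex function: the convex combination of optimal controls is
feasible because the dynamics are linear. -/
theorem LinearConvex.convexOn_value (hP : P.LinearConvex)
    (hγ : ConvexOn ℝ (P.X t.castSucc ×ˢ P.U t) γ) (hw : ConvexOn ℝ Set.univ w)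
    {v : Vec n → ℝ}
    (hle : ∀ x ∈ P.X t.castSucc, ∀ u ∈ P.feasible t x, v x ≤ γ (x, u) + w (P.f t x u))
    (hmin : ∀ x ∈ P.X t.castSucc, ∃ u ∈ P.feasible t x, v x = γ (x, u) + w (P.f t x u)) :
    ConvexOn ℝ (P.X t.castSucc) v := by
  refine ⟨hP.convex_X _, fun x hx y hy a b ha hb hab => ?_⟩
  obtain ⟨u, hu, hxu⟩ := hmin x hx
  obtain ⟨u', hu', hyu⟩ := hmin y hy
  have hf := P.f_combo t x y u u' a b
  have h1 := hγ.2 (x := (x, u)) ⟨hx, hu.1⟩ (y := (y, u')) ⟨hy, hu'.1⟩ ha hb hab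
  have h2 := hw.2 (Set.mem_univ (P.f t x u)) (Set.mem_univ (P.f t y u')) ha hb hab
  have h3 := hle _ (hP.convex_X _ hx hy ha hb hab) (a • u + b • u')
    ⟨hP.convex_U t hu.1 hu'.1 ha hb hab, by
      rw [hf]; exact hP.convex_X _ hu.2 hu'.2 ha hb hab⟩
  rw [hf] at h3
  simp only [Prod.smul_mk, Prod.mk_add_mk, smul_eq_mul] at h1 h2 ⊢
  rw [hxu, hyu]
  linarith

/-- An optimal control at `y` is moved to a feasible control at `x`; the first term of the constant
pays for the stage cost, the second for the cost-to-go. -/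
theorem lipschitzOnWith_value {K : ℝ≥0}
    (hK : ∀ x ∈ P.X t.castSucc, ∀ x' ∈ P.X t.castSucc, ∀ u ∈ P.feasible t x,
      ∃ u' ∈ P.feasible t x', ‖u' - u‖ ≤ K * ‖x' - x‖)
    (hγ : LipschitzOnWith C γ (P.X t.castSucc ×ˢ P.U t)) (hw : LipschitzWith ℓ w)
    {v : Vec n → ℝ}
    (hle : ∀ x ∈ P.X t.castSucc, ∀ u ∈ P.feasible t x, v x ≤ γ (x, u) + w (P.f t x u))
    (hmin : ∀ x ∈ P.X t.castSucc, ∃ u ∈ P.feasible t x, v x = γ (x, u) + w (P.f t x u)) :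
    LipschitzOnWith (C * (1 + K) + ℓ * (‖(P.A t).toContinuousLinearMap‖₊ +
      ‖(P.B t).toContinuousLinearMap‖₊ * K)) v (P.X t.castSucc) := by
  refine LipschitzOnWith.of_le_add_mul _ fun x hx y hy => ?_
  obtain ⟨u, hu, hyu⟩ := hmin y hy
  obtain ⟨u', hu', hd⟩ := hK y hy x hx u hu
  rw [← dist_eq_norm, ← dist_eq_norm] at hd
  have h1 := hle x hx u' hu'
  have h2 := hγ.le_add_mul (x := (x, u')) ⟨hx, hu'.1⟩ (y := (y, u)) ⟨hy, hu.1⟩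
  have h3 := hw.le_add_mul (P.f t x u') (P.f t y u)
  have h4 : dist (x, u') (y, u) ≤ (1 + K) * dist x y := by
    rw [Prod.dist_eq]
    have : 0 ≤ (K : ℝ) * dist x y := by positivity
    exact max_le (by linarith [dist_nonneg (x := x) (y := y)])
      (by linarith [dist_nonneg (x := x) (y := y)])
  have h5 : dist (P.f t x u') (P.f t y u) ≤ (‖(P.A t).toContinuousLinearMap‖ +
      ‖(P.B t).toContinuousLinearMap‖ * K) * dist x y := by
    have hA := (P.A t).toContinuousLinearMap.lipschitz.dist_le_mul x y
    have hB := (P.B t).toContinuousLinearMap.lipschitz.dist_le_mul u' u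
    refine (dist_add_add_le _ _ _ _).trans ((add_le_add hA (hB.trans
      (mul_le_mul_of_nonneg_left hd (by positivity)))).trans (le_of_eq ?_))
    simp only [coe_nnnorm]; ring
  have h6 := mul_le_mul_of_nonneg_left h4 C.2
  have h7 := mul_le_mul_of_nonneg_left h5 ℓ.2
  simp only [NNReal.val_eq_coe] at h6 h7
  push_cast
  rw [hyu]
  linarith

end Stage

/-! ### Existence of a selection function -/

theorem LinearConvex.exists_lipschitz_feasible (hP : P.LinearConvex) (hS : P.StrictRecourse)
    (t : Fin T) : ∃ K : ℝ≥0,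
      ∀ x ∈ P.X t.castSucc, ∀ x' ∈ P.X t.castSucc, ∀ u ∈ P.feasible t x,
        ∃ u' ∈ P.feasible t x', ‖u' - u‖ ≤ K * ‖x' - x‖ := by
  obtain ⟨K, hK⟩ := exists_lipschitz_recourse (hP.compact_X t.castSucc)
    (hP.compact_U t).isBounded (hP.convex_U t) (hP.convex_X t.succ) (P.A t) (P.B t)
    fun x hx => by
      obtain ⟨_, ⟨u, hu, rfl⟩, h⟩ := hS t x hx
      exact ⟨u, hu, h⟩
  refine ⟨K, fun x hx x' hx' u hu => ?_⟩
  obtain ⟨u', h1, h2, h3⟩ := hK x hx x' hx' u hu.1 hu.2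
  exact ⟨u', ⟨h1, h2⟩, h3⟩

/-- A subgradient at `x` of the stage value function is a multiplier of `x' = x`. The bound `ℓ'` is
fixed before `L` and `F`, which permits the backward choice of the constants. -/
theorem LinearConvex.exists_slope_bound (hP : P.LinearConvex) (hS : P.StrictRecourse)
    (t : Fin T) (ℓ : ℝ≥0) : ∃ ℓ' : ℝ≥0, ∀ L : Fin (T + 1) → ℝ≥0,
      L t.succ = ℓ → L t.castSucc = ℓ' → ∀ F ⊆ P.basic L t.succ, F.Finite → F.Nonempty →
        ∀ x ∈ P.X t.castSucc, ∃ φ, P.IsCut L t F x φ := by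
  obtain ⟨K, hK⟩ := hP.exists_lipschitz_feasible hS t
  obtain ⟨γ, C, hc, hγ, hγc⟩ := hP.exists_stageCost t
  refine ⟨C * (1 + K) + ℓ * (‖(P.A t).toContinuousLinearMap‖₊ +
    ‖(P.B t).toContinuousLinearMap‖₊ * K), fun L hL hL' F hF hfin hne x hx => ?_⟩
  obtain ⟨w, hw, hwc, hsup⟩ := exists_supOf_basic hF hfin hne
  rw [hL] at hw
  choose! us hus hmin using fun x (hx : x ∈ P.X t.castSucc) => hP.exists_minimizer hγ hw hx
  set v : Vec n → ℝ := fun x => γ (x, us x) + w (P.f t x (us x)) with hv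
  have hex : ∀ x ∈ P.X t.castSucc, ∃ u ∈ P.feasible t x, v x = γ (x, u) + w (P.f t x u) :=
    fun x hx => ⟨us x, hus x hx, rfl⟩
  obtain ⟨a, ha, hsub⟩ := exists_subgradient_of_lipschitzOnWith
    (hP.convexOn_value hγc hwc hmin hex) (lipschitzOnWith_value hK hγ hw hmin hex) hx
  refine ⟨_, us x, w (P.f t x (us x)), a, v x, ⟨?_, ?_, ?_, ?_⟩, by rw [hL']; exact ha, rfl⟩
  · exact (mem_nodalSet_iff hsup).2 ⟨hx, (hus x hx).1, (hus x hx).2, le_rfl⟩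
  · rw [nodalCost, hc x hx _ (hus x hx).1, hv, EReal.coe_add]
  · rintro ⟨x', u, r⟩ hp rfl
    obtain ⟨h1, h2, h3, h4⟩ := (mem_nodalSet_iff hsup).1 hp
    have := hmin x' h1 u ⟨h2, h3⟩
    rw [nodalCost, hc x' h1 u h2]
    norm_cast
    simp only [hv]
    linarith
  · rintro ⟨x', u, r⟩ hp
    obtain ⟨h1, h2, h3, h4⟩ := (mem_nodalSet_iff hsup).1 hp
    have h5 := hmin x' h1 u ⟨h2, h3⟩
    have h6 := hsub x' h1
    simp only [Set.mem_ofPred_eq, lagrangian, nodalCost, hc x' h1 u h2,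
      hc x hx _ (hus x hx).1]
    norm_cast
    simp only [sub_self, inner_zero_right]
    linarith

theorem LinearConvex.exists_finalCut (hP : P.LinearConvex) : ∃ C : ℝ≥0,
    ∀ L : Fin (T + 1) → ℝ≥0, L (Fin.last T) = C → ∀ x ∈ P.X (Fin.last T),
      ∃ φ, P.IsFinalCut L x φ := by
  obtain ⟨C, g, hg, hgL⟩ := hP.lipschitz_ψ
  refine ⟨C, fun L hL x hx => ?_⟩
  obtain ⟨a, ha, hsub⟩ := exists_subgradient_of_lipschitzOnWith
    (hP.convex_ψ.convexOn (hP.convex_X _) hg) hgL hx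
  refine ⟨_, a, fun y => ?_, by rwa [hL], rfl⟩
  rw [V_last, restrictTo_of_mem hx, hg x hx]
  by_cases hy : y ∈ P.X (Fin.last T)
  · rw [restrictTo_of_mem hy, hg y hy]
    have := hsub y hy
    norm_cast
    linarith
  · rw [restrictTo_of_notMem hy]
    exact le_top

theorem LinearConvex.exists_isSelection (hP : P.LinearConvex) (hS : P.StrictRecourse) :
    ∃ (L : Fin (T + 1) → ℝ≥0)
      (sel : Fin (T + 1) → Set (Vec n → EReal) → Vec n → Vec n → EReal), P.IsSelection L sel := by
  choose κ hκ using hP.exists_slope_bound hS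
  obtain ⟨C, hC⟩ := hP.exists_finalCut
  let L : Fin (T + 1) → ℝ≥0 := Fin.reverseInduction (motive := fun _ => ℝ≥0) C fun t ℓ => κ t ℓ
  have hLlast : L (Fin.last T) = C := Fin.reverseInduction_last ..
  have hLcast : ∀ t : Fin T, L t.castSucc = κ t (L t.succ) :=
    fun t => Fin.reverseInduction_castSucc ..
  -- One predicate covers both kinds of time; for each `t` one of the two implications is vacuous.
  refine ⟨L, fun t F x => Classical.epsilon fun φ =>
    (∀ s : Fin T, s.castSucc = t → P.IsCut L s F x φ) ∧
      (t = Fin.last T → P.IsFinalCut L x φ), ⟨fun t F hF hfin hne x hx => ?_,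
      fun F _ _ x hx => ?_⟩⟩
  · obtain ⟨φ, hφ⟩ := hκ t (L t.succ) L rfl (hLcast t) F hF hfin hne x hx
    refine (Classical.epsilon_spec (p := fun φ : Vec n → EReal =>
      (∀ s : Fin T, s.castSucc = t.castSucc → P.IsCut L s F x φ) ∧
      (t.castSucc = Fin.last T → P.IsFinalCut L x φ)) ⟨φ, fun s hs => ?_, fun h => ?_⟩).1 t rfl
    · rwa [Fin.castSucc_injective _ hs]
    · exact absurd h (Fin.castSucc_ne_last t)
  · obtain ⟨φ, hφ⟩ := hC L hLlast x hx
    exact (Classical.epsilon_spec (p := fun φ : Vec n → EReal =>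
      (∀ s : Fin T, s.castSucc = Fin.last T → P.IsCut L s F x φ) ∧
      (Fin.last T = Fin.last T → P.IsFinalCut L x φ))
      ⟨φ, fun s hs => absurd hs (Fin.castSucc_ne_last s), fun _ => hφ⟩).2 rfl

end Problem

/-! ### Almost sure equality with the optimal trajectories -/

theorem pi_uniformOn_singleton {n : ℕ} {ι : Type*} [Fintype ι] (y : ι → Vec n) :
    (Measure.pi fun t => uniformOn {y t}) = Measure.dirac y := by
  classical
  have h : (fun t => uniformOn {y t}) = fun t => Measure.dirac (y t) := by
    funext t
    ext s hs
    rw [uniformOn_singleton, Measure.dirac_apply' _ hs, Set.indicator_apply]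
    rfl
  rw [h]
  refine Measure.pi_eq fun s hs => ?_
  rw [Measure.dirac_apply' _ (MeasurableSet.univ_pi hs)]
  simp only [Measure.dirac_apply' _ (hs _), Set.indicator_apply, Pi.one_apply, Set.mem_univ_pi]
  rw [Finset.prod_ite_zero]
  simp

/-- Since `B` need not be measurable, it is replaced by the `m`-measurable set `B'` where the
conditional probability is `1`. Integrating over the whole space and over `B'` gives `A`, `B'` and
`A ∩ B'` the same measure. -/
theorem ae_mem_iff_of_condExp_eq_indicator {Ω : Type*} {m m0 : MeasurableSpace Ω} (hm : m ≤ m0)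
    {μ : Measure Ω} [IsProbabilityMeasure μ] {A B : Set Ω} (hA : MeasurableSet A)
    (h : μ⟦A | m⟧ =ᵐ[μ] B.indicator fun _ => (1 : ℝ)) : ∀ᵐ ω ∂μ, ω ∈ A ↔ ω ∈ B := by
  classical
  have hint : Integrable (A.indicator fun _ => (1 : ℝ)) μ :=
    (integrable_const 1).indicator hA
  set g := μ⟦A | m⟧
  have hg : StronglyMeasurable[m] g := stronglyMeasurable_condExp
  set B' : Set Ω := {ω | g ω = 1}
  have hB' : MeasurableSet[m] B' := hg.measurable (measurableSet_singleton (1 : ℝ))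
  have hBB' : ∀ᵐ ω ∂μ, ω ∈ B' ↔ ω ∈ B := by
    filter_upwards [h] with ω hω
    change g ω = 1 ↔ _
    rw [hω, Set.indicator_apply]
    split_ifs with hb <;> simp [hb]
  have hgB : g =ᵐ[μ] B'.indicator fun _ => (1 : ℝ) := by
    filter_upwards [h, hBB'] with ω h1 h2
    rw [h1]
    by_cases hb : ω ∈ B
    · rw [Set.indicator_of_mem hb, Set.indicator_of_mem (h2.2 hb)]
    · rw [Set.indicator_of_notMem hb, Set.indicator_of_notMem fun hb' => hb (h2.1 hb')]
  have e1 : μ.real A = μ.real B' := by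
    have := integral_condExp hm (μ := μ) (f := A.indicator fun _ => (1 : ℝ))
    rw [integral_congr_ae hgB, integral_indicator_const _ (hm _ hB'),
      integral_indicator_const _ hA] at this
    simpa using this.symm
  have e2 : μ.real (A ∩ B') = μ.real B' := by
    have := setIntegral_condExp hm hint hB'
    rw [setIntegral_congr_ae (g := B'.indicator fun _ => (1 : ℝ)) (hm _ hB')
        (hgB.mono fun ω hω _ => hω), integral_indicator_const _ (hm _ hB'),
      integral_indicator_const _ hA] at this
    simpa [measureReal_restrict_apply (hm _ hB'), measureReal_restrict_apply hA] using this.symm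
  have hA' : (A ∩ B' : Set Ω) =ᵐ[μ] A :=
    ae_eq_of_subset_of_measure_ge Set.inter_subset_left
      ((ENNReal.toReal_le_toReal (measure_ne_top _ _) (measure_ne_top _ _)).1 (e1.trans e2.symm).le)
      (hA.inter (hm _ hB')).nullMeasurableSet (measure_ne_top _ _)
  have hB'' : (A ∩ B' : Set Ω) =ᵐ[μ] B' :=
    ae_eq_of_subset_of_measure_ge Set.inter_subset_right
      ((ENNReal.toReal_le_toReal (measure_ne_top _ _) (measure_ne_top _ _)).1 e2.symm.le)
      (hA.inter (hm _ hB')).nullMeasurableSet (measure_ne_top _ _)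
  filter_upwards [(hA'.symm.trans hB'').mem_iff, hBB'] with ω h1 h2
  exact h1.trans h2

/-- The uniform law on singletons is a Dirac mass at the trajectory, so draw and trajectory almost
surely lie in the same sets of a countable basis, which separates points. Measurability of `traj` is
not needed. -/
theorem IsDraws.ae_eq_traj {n T : ℕ} {Ω : Type*} [MeasurableSpace Ω] {Pr : Measure Ω}
    [IsProbabilityMeasure Pr] {μ₀ : Measure (Fin (T + 1) → Vec n)}
    {K₀ : Fin (T + 1) → Set (Vec n)} {draw traj : ℕ → Ω → Fin (T + 1) → Vec n}
    (h : IsDraws Pr μ₀ (fun k ω => trialSets K₀ (fun j => traj j ω) k) draw) :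
    ∀ᵐ ω ∂Pr, ∀ k, draw (k + 1) ω = traj (k + 1) ω := by
  rw [ae_all_iff]
  intro k
  have hm : MeasurableSpace.comap (fun ω (j : Fin (k + 1)) => draw j ω) MeasurableSpace.pi
      ≤ (inferInstance : MeasurableSpace Ω) :=
    (measurable_pi_lambda _ fun j : Fin (k + 1) => h.measurable j).comap_le
  have key : ∀ S ∈ TopologicalSpace.countableBasis (Fin (T + 1) → Vec n),
      ∀ᵐ ω ∂Pr, draw (k + 1) ω ∈ S ↔ traj (k + 1) ω ∈ S := by
    intro S hS
    have hSm : MeasurableSet S := (TopologicalSpace.isOpen_of_mem_countableBasis hS).measurableSet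
    refine ae_mem_iff_of_condExp_eq_indicator (A := draw (k + 1) ⁻¹' S)
      (B := traj (k + 1) ⁻¹' S) hm (h.measurable _ hSm) ((h.law_succ k S hSm).trans ?_)
    refine Eventually.of_forall fun ω => ?_
    simp only [trialSets, pi_uniformOn_singleton, measureReal_def, Measure.dirac_apply' _ hSm]
    by_cases hω : traj (k + 1) ω ∈ S <;> simp [hω]
  filter_upwards [(ae_ball_iff (TopologicalSpace.countable_countableBasis _)).2 key] with ω hω
  exact ((TopologicalSpace.isBasis_countableBasis _).inseparable_iff.2 fun S hS => hω S hS).eq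

/-! ### The sets of basic functions -/

section Sets

variable {n T : ℕ} {sel : Fin (T + 1) → Set (Vec n → EReal) → Vec n → Vec n → EReal}
  {x : ℕ → Fin (T + 1) → Vec n}

theorem tdpSets_succ_last (k : ℕ) :
    tdpSets sel x (k + 1) (Fin.last T) = tdpSets sel x k (Fin.last T) ∪
      {sel (Fin.last T) (tdpSets sel x k (Fin.last T)) (x k (Fin.last T))} := by
  rw [tdpSets, Fin.reverseInduction_last]

theorem tdpSets_succ_castSucc (k : ℕ) (t : Fin T) :
    tdpSets sel x (k + 1) t.castSucc = tdpSets sel x k t.castSucc ∪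
      {sel t.castSucc (tdpSets sel x (k + 1) t.succ) (x k t.castSucc)} := by
  rw [tdpSets, Fin.reverseInduction_castSucc]

theorem exists_tdpSets_succ (k : ℕ) (t : Fin (T + 1)) :
    ∃ φ, tdpSets sel x (k + 1) t = tdpSets sel x k t ∪ {φ} := by
  induction t using Fin.lastCases with
  | last => exact ⟨_, tdpSets_succ_last k⟩
  | cast t => exact ⟨_, tdpSets_succ_castSucc k t⟩

theorem tdpSets_subset_succ (k : ℕ) (t : Fin (T + 1)) :
    tdpSets sel x k t ⊆ tdpSets sel x (k + 1) t := by
  obtain ⟨φ, h⟩ := exists_tdpSets_succ (sel := sel) (x := x) k t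
  rw [h]
  exact Set.subset_union_left

theorem tdpSets_succ_nonempty (k : ℕ) (t : Fin (T + 1)) : (tdpSets sel x (k + 1) t).Nonempty := by
  obtain ⟨φ, h⟩ := exists_tdpSets_succ (sel := sel) (x := x) k t
  rw [h]
  exact ⟨φ, Or.inr rfl⟩

theorem finite_tdpSets (k : ℕ) (t : Fin (T + 1)) : (tdpSets sel x k t).Finite := by
  induction k with
  | zero => exact Set.finite_empty
  | succ k ih =>
    obtain ⟨φ, h⟩ := exists_tdpSets_succ (sel := sel) (x := x) k t
    rw [h]
    exact ih.union (Set.finite_singleton φ)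

theorem supOf_union_singleton {E : Type*} (F : Set (E → EReal)) (φ : E → EReal) :
    supOf (F ∪ {φ}) = supOf F ⊔ φ := by
  funext y
  simp only [supOf, iSup_union, Set.mem_singleton_iff, iSup_iSup_eq_left, Pi.sup_apply]

theorem approx_monotone (t : Fin (T + 1)) : Monotone fun k => approx sel x k t :=
  monotone_nat_of_le_succ fun k _ => biSup_mono fun _ h => tdpSets_subset_succ k t h

end Sets

namespace Problem

variable {n m T : ℕ} {P : Problem n m T} {L : Fin (T + 1) → ℝ≥0}
  {sel : Fin (T + 1) → Set (Vec n → EReal) → Vec n → Vec n → EReal}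
  {x : ℕ → Fin (T + 1) → Vec n}

/-! ### Value functions and cuts -/

theorem LinearConvex.V_lt_top (hP : P.LinearConvex) (t : Fin (T + 1)) :
    ∀ z ∈ P.X t, P.V t z < ⊤ := by
  induction t using Fin.reverseInduction with
  | last =>
    intro z hz
    obtain ⟨C, g, hg, -⟩ := hP.lipschitz_ψ
    rw [V_last, restrictTo_of_mem hz, hg z hz]
    exact EReal.coe_lt_top _
  | cast t ih =>
    intro z hz
    obtain ⟨u, hu⟩ := hP.feasible_nonempty t hz
    obtain ⟨γ, C, hc, -, -⟩ := hP.exists_stageCost t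
    rw [V_castSucc, restrictTo_of_mem hz]
    refine (iInf₂_le u hu.1).trans_lt ?_
    rw [bellmanAt, hc z hz u hu.1]
    exact EReal.add_lt_top (EReal.coe_ne_top _) (ih _ hu.2).ne

theorem V_of_notMem (t : Fin (T + 1)) {z : Vec n} (hz : z ∉ P.X t) : P.V t z = ⊤ := by
  induction t using Fin.lastCases with
  | last => rw [V_last, restrictTo_of_notMem hz]
  | cast t => rw [V_castSucc, restrictTo_of_notMem hz]

theorem LinearConvex.dom_V (hP : P.LinearConvex) (t : Fin (T + 1)) : dom (P.V t) = P.X t := by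
  ext z
  refine ⟨fun h => ?_, hP.V_lt_top t z⟩
  by_contra hz
  exact (ne_of_lt h) (V_of_notMem t hz)

theorem IsCut.mem_basic {t : Fin T} {F : Set (Vec n → EReal)} {z : Vec n} {φ : Vec n → EReal}
    (h : P.IsCut L t F z φ) : φ ∈ P.basic L t.castSucc := by
  obtain ⟨u, r, a, b, -, ha, rfl⟩ := h
  refine ⟨a, b - inner ℝ a z, ha, restrictTo_congr fun y _ => ?_⟩
  rw [inner_sub_right]
  congr 1
  ring

theorem LinearConvex.mem_basic_of_isFinalCut (hP : P.LinearConvex) {z : Vec n}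
    (hz : z ∈ P.X (Fin.last T)) {φ : Vec n → EReal} (h : P.IsFinalCut L z φ) :
    φ ∈ P.basic L (Fin.last T) := by
  obtain ⟨a, -, ha, rfl⟩ := h
  obtain ⟨C, g, hg, -⟩ := hP.lipschitz_ψ
  refine ⟨a, g z - inner ℝ a z, ha, restrictTo_congr fun y _ => ?_⟩
  rw [V_last, restrictTo_of_mem hz, hg z hz, inner_sub_right, ← EReal.coe_add]
  congr 1
  ring

/-- Weak duality: stationarity bounds the cut at `y` by the nodal cost of every `(y, v, s)` in the
nodal set, in particular with `s` the next value function. -/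
theorem LinearConvex.cut_le (hP : P.LinearConvex) {t : Fin T} {F : Set (Vec n → EReal)}
    {z : Vec n} {φ : Vec n → EReal} (h : P.IsCut L t F z φ) (hF : F ⊆ P.basic L t.succ)
    (hfin : F.Finite) (hne : F.Nonempty) (hle : supOf F ≤ P.V t.succ) : φ ≤ P.V t.castSucc := by
  obtain ⟨u, r, a, b, hN, ha, rfl⟩ := h
  obtain ⟨w, -, -, hw⟩ := exists_supOf_basic hF hfin hne
  obtain ⟨γ, C, hc, -, -⟩ := hP.exists_stageCost t
  intro y
  by_cases hy : y ∈ P.X t.castSucc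
  swap
  · rw [V_of_notMem _ hy]; exact le_top
  rw [V_castSucc, restrictTo_of_mem hy, restrictTo_of_mem hy]
  refine le_iInf₂ fun v hv => ?_
  have h1 := hle (P.f t y v)
  rw [bellmanAt, hc y hy v hv]
  generalize hV : P.V t.succ (P.f t y v) = s at h1
  induction s using EReal.rec with
  -- Impossible: a supremum of finitely many cuts, at least one, is never `⊥`.
  | bot =>
    have := h1.trans (bot_le : (⊥ : EReal) ≤ ((w (P.f t y v) - 1 : ℝ) : EReal))
    rw [hw, restrictTo_coe_le_coe] at this
    linarith [this.2]
  | top => simp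
  | coe s =>
    have hmem : (y, v, s) ∈ P.nodalSet t F := ⟨hy, hv, le_iff_supOf_le.2 h1⟩
    have h2 := hN.stationary hmem
    simp only [Set.mem_ofPred_eq, lagrangian, hN.value, sub_self, inner_zero_right] at h2
    rw [nodalCost, hc y hy v hv] at h2
    norm_cast at h2
    dsimp only at h2
    rw [← EReal.coe_add]
    exact EReal.coe_le_coe_iff.2 (by linarith)

theorem IsFinalCut.le {z : Vec n} {φ : Vec n → EReal} (h : P.IsFinalCut L z φ) :
    φ ≤ P.V (Fin.last T) := by
  obtain ⟨a, h1, -, rfl⟩ := h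
  intro y
  by_cases hy : y ∈ P.X (Fin.last T)
  · rw [restrictTo_of_mem hy]; exact h1 y
  · rw [V_of_notMem _ hy]; exact le_top

theorem IsFinalCut.apply_self {z : Vec n} (hz : z ∈ P.X (Fin.last T)) {φ : Vec n → EReal}
    (h : P.IsFinalCut L z φ) : φ z = P.V (Fin.last T) z := by
  obtain ⟨a, -, -, rfl⟩ := h
  rw [restrictTo_of_mem hz]
  simp

/-- Tightness at the trial point: the epigraph variable `r` dominates the supremum of `F` at the
next state. -/
theorem IsCut.exists_bellmanAt_le {t : Fin T} {F : Set (Vec n → EReal)} {z : Vec n}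
    {φ : Vec n → EReal} (h : P.IsCut L t F z φ) :
    ∃ u ∈ P.U t, P.bellmanAt t (supOf F) z u ≤ φ z := by
  obtain ⟨u, r, a, b, hN, -, rfl⟩ := h
  obtain ⟨h1, h2, h3⟩ := hN.feasible
  refine ⟨u, h2, ?_⟩
  rw [restrictTo_of_mem h1, sub_self, inner_zero_right, zero_add, ← hN.value]
  exact add_le_add le_rfl (le_iff_supOf_le.1 h3)

/-! ### Properties of the approximations -/

theorem LinearConvex.tdpSets_spec (hP : P.LinearConvex) (hsel : P.IsSelection L sel) (k : ℕ)
    (hx : ∀ j < k, ∀ t, x j t ∈ P.X t) (t : Fin (T + 1)) :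
    tdpSets sel x k t ⊆ P.basic L t ∧ approx sel x k t ≤ P.V t := by
  induction k generalizing t with
  | zero =>
    refine ⟨Set.empty_subset _, fun y => ?_⟩
    simp [approx, supOf, tdpSets]
  | succ k ih =>
    have ih' := ih fun j hj => hx j (hj.trans (Nat.lt_succ_self k))
    have hxk := hx k (Nat.lt_succ_self k)
    induction t using Fin.reverseInduction with
    | last =>
      have hc := hsel.final _ (ih' (Fin.last T)).1 (finite_tdpSets k _) _ (hxk _)
      rw [approx, tdpSets_succ_last, supOf_union_singleton]
      exact ⟨Set.union_subset (ih' _).1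
        (Set.singleton_subset_iff.2 (hP.mem_basic_of_isFinalCut (hxk _) hc)),
        sup_le (ih' _).2 hc.le⟩
    | cast t iht =>
      have hc := hsel.stage t _ iht.1 (finite_tdpSets _ _) (tdpSets_succ_nonempty _ _) _ (hxk _)
      rw [approx, tdpSets_succ_castSucc, supOf_union_singleton]
      exact ⟨Set.union_subset (ih' _).1 (Set.singleton_subset_iff.2 hc.mem_basic),
        sup_le (ih' _).2 (hP.cut_le hc iht.1 (finite_tdpSets _ _) (tdpSets_succ_nonempty _ _)
          iht.2)⟩

theorem LinearConvex.exists_approx_eq (hP : P.LinearConvex) (hsel : P.IsSelection L sel) (k : ℕ)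
    (hx : ∀ j < k + 1, ∀ t, x j t ∈ P.X t) (t : Fin (T + 1)) :
    ∃ w : Vec n → ℝ, LipschitzWith (L t) w ∧ ConvexOn ℝ Set.univ w ∧
      approx sel x (k + 1) t = restrictTo (P.X t) fun y => (w y : EReal) :=
  exists_supOf_basic (hP.tdpSets_spec hsel (k + 1) hx t).1 (finite_tdpSets _ _)
    (tdpSets_succ_nonempty _ _)

/-- The approximations are `+∞` off the state sets while recourse offers a control of finite cost,
so a minimizer cannot leave them. -/
theorem LinearConvex.mem_of_isOptimalTrajectory (hP : P.LinearConvex)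
    {W : Fin (T + 1) → Vec n → EReal}
    (hW : ∀ t, ∃ w : Vec n → ℝ, W t = restrictTo (P.X t) fun y => (w y : EReal))
    {x₀ : Vec n} (hx₀ : x₀ ∈ P.X 0) {y : Fin (T + 1) → Vec n}
    (hy : P.IsOptimalTrajectory W x₀ y) (t : Fin (T + 1)) : y t ∈ P.X t := by
  induction t using Fin.induction with
  | zero => rw [hy.1]; exact hx₀
  | succ t ih =>
    obtain ⟨u, hu, hmin, hs⟩ := hy.2 t
    obtain ⟨w, hw⟩ := hW t.succ
    obtain ⟨γ, C, hc, -, -⟩ := hP.exists_stageCost t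
    obtain ⟨v, hv⟩ := hP.feasible_nonempty t ih
    by_contra hn
    rw [hs] at hn
    have := hmin hv.1
    simp only [Set.mem_ofPred_eq, bellmanAt, hc _ ih u hu, hc _ ih v hv.1, hw,
      restrictTo_of_notMem hn, restrictTo_of_mem hv.2, EReal.coe_add_top, top_le_iff] at this
    exact EReal.coe_ne_top _ this

theorem LinearConvex.points_mem (hP : P.LinearConvex) (hsel : P.IsSelection L sel)
    {x₀ : Vec n} (hx₀ : x₀ ∈ P.X 0) (h0 : ∀ t, x 0 t ∈ P.X t)
    (hx : ∀ k, P.IsOptimalTrajectory (approx sel x (k + 1)) x₀ (x (k + 1))) (k : ℕ) :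
    ∀ t, x k t ∈ P.X t := by
  induction k using Nat.strong_induction_on with
  | _ k ih =>
    cases k with
    | zero => exact h0
    | succ k =>
      exact hP.mem_of_isOptimalTrajectory (fun t => by
        obtain ⟨w, -, -, hw⟩ := hP.exists_approx_eq hsel k ih t
        exact ⟨w, hw⟩) hx₀ (hx k)

/-- The approximation computed at iteration `k + 1` is exact at the last trial point. -/
theorem LinearConvex.V_last_le_approx (hP : P.LinearConvex) (hsel : P.IsSelection L sel) (k : ℕ)
    (hx : ∀ j < k + 1, ∀ t, x j t ∈ P.X t) :
    P.V (Fin.last T) (x k (Fin.last T)) ≤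
      approx sel x (k + 1) (Fin.last T) (x k (Fin.last T)) := by
  have hxk := hx k (Nat.lt_succ_self k)
  have hc := hsel.final _ (hP.tdpSets_spec hsel k
    (fun j hj => hx j (hj.trans (Nat.lt_succ_self k))) (Fin.last T)).1 (finite_tdpSets k _) _ (hxk _)
  rw [approx, tdpSets_succ_last, supOf_union_singleton, ← hc.apply_self (hxk _)]
  exact le_sup_right (a := supOf _ _)

/-- The cut at time `t` uses the already updated family at `t + 1`, which dominates the old one; the
trajectory control `u` is optimal for the old one. -/
theorem LinearConvex.bellmanAt_le_approx (hP : P.LinearConvex) (hsel : P.IsSelection L sel)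
    (k : ℕ) (hx : ∀ j < k + 1, ∀ t, x j t ∈ P.X t) (t : Fin T) {u : Vec m}
    (hu : IsMinOn (P.bellmanAt t (approx sel x k t.succ) (x k t.castSucc)) (P.U t) u) :
    P.bellmanAt t (approx sel x k t.succ) (x k t.castSucc) u ≤
      approx sel x (k + 1) t.castSucc (x k t.castSucc) := by
  have hxk := hx k (Nat.lt_succ_self k)
  have hc := hsel.stage t _ (hP.tdpSets_spec hsel (k + 1) hx t.succ).1 (finite_tdpSets _ _)
    (tdpSets_succ_nonempty _ _) _ (hxk _)
  obtain ⟨v, hv, hle⟩ := hc.exists_bellmanAt_le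
  have h1 : approx sel x (k + 1) t.castSucc (x k t.castSucc) =
      approx sel x k t.castSucc (x k t.castSucc) ⊔
        sel t.castSucc (tdpSets sel x (k + 1) t.succ) (x k t.castSucc) (x k t.castSucc) := by
    rw [approx, tdpSets_succ_castSucc, supOf_union_singleton]; rfl
  rw [h1]
  exact (hu hv).trans ((add_le_add le_rfl (approx_monotone t.succ (Nat.le_succ k) _)).trans
    (hle.trans le_sup_right))

end Problem

/-! ### Monotone limits of equi-Lipschitz functions -/

/-- The Lipschitz bound and convexity pass to the pointwise limit; its continuity then allows Dini's
theorem. -/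
theorem exists_limit_of_monotone_lipschitz {E : Type*} [NormedAddCommGroup E] [NormedSpace ℝ E]
    {S : Set E} (hS : IsCompact S) (hSc : Convex ℝ S) {ℓ : ℝ≥0} {w : ℕ → E → ℝ} {b : E → ℝ}
    (hw : ∀ k, LipschitzWith ℓ (w k)) (hwc : ∀ k, ConvexOn ℝ Set.univ (w k))
    (hmono : ∀ z ∈ S, Monotone fun k => w k z) (hb : ∀ k, ∀ z ∈ S, w k z ≤ b z) :
    ∃ g : E → ℝ, LipschitzOnWith ℓ g S ∧ ConvexOn ℝ S g ∧ TendstoUniformlyOn w g atTop S ∧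
      ∀ z ∈ S, g z ≤ b z := by
  have hex : ∀ z ∈ S, ∃ r, Tendsto (fun k => w k z) atTop (𝓝 r) := fun z hz =>
    ⟨_, tendsto_atTop_ciSup (hmono z hz) ⟨b z, by rintro _ ⟨k, rfl⟩; exact hb k z hz⟩⟩
  choose! g hg using hex
  have hgL : LipschitzOnWith ℓ g S := LipschitzOnWith.of_dist_le_mul fun y hy z hz =>
    le_of_tendsto ((hg y hy).dist (hg z hz))
      (Eventually.of_forall fun k => (hw k).dist_le_mul y z)
  refine ⟨g, hgL, ⟨hSc, fun y hy z hz p q hp hq hpq => ?_⟩,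
    Monotone.tendstoUniformlyOn_of_forall_tendsto hS (fun k => (hw k).continuous.continuousOn)
      hmono hgL.continuousOn hg, fun z hz => le_of_tendsto' (hg z hz) fun k => hb k z hz⟩
  exact le_of_tendsto_of_tendsto' (hg _ (hSc hy hz hp hq hpq))
    (((hg y hy).const_smul p).add ((hg z hz).const_smul q))
    fun k => (hwc k).2 (Set.mem_univ y) (Set.mem_univ z) hp hq hpq

theorem tendsto_apply_of_tendstoUniformlyOn {E : Type*} [TopologicalSpace E] {S : Set E}
    {w : ℕ → E → ℝ} {g : E → ℝ} (h : TendstoUniformlyOn w g atTop S) (hg : ContinuousOn g S)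
    {m : ℕ → ℕ} (hm : Tendsto m atTop atTop) {y : ℕ → E} {z : E} (hy : ∀ j, y j ∈ S) (hz : z ∈ S)
    (hyz : Tendsto y atTop (𝓝 z)) : Tendsto (fun j => w (m j) (y j)) atTop (𝓝 (g z)) := by
  have h' : TendstoUniformlyOn (fun j => w (m j)) g atTop S := fun u hu => hm.eventually (h u hu)
  exact h'.tendsto_comp (hg z hz) (tendsto_nhdsWithin_iff.2 ⟨hyz, Eventually.of_forall hy⟩)

theorem isConvex_restrictTo {E : Type*} [AddCommGroup E] [Module ℝ E] {S : Set E} {g : E → ℝ}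
    (hg : ConvexOn ℝ S g) : IsConvex (restrictTo S fun z => (g z : EReal)) := by
  have := hg.convex_epigraph
  unfold IsConvex
  convert this using 3
  exact restrictTo_coe_le_coe

/-! ### Convergence along one run -/

namespace Problem

variable {n m T : ℕ} {P : Problem n m T} {L : Fin (T + 1) → ℝ≥0}
  {sel : Fin (T + 1) → Set (Vec n → EReal) → Vec n → Vec n → EReal}
  {x : ℕ → Fin (T + 1) → Vec n}

theorem LinearConvex.restrictTo_mem_regular (hP : P.LinearConvex) {t : Fin (T + 1)} {g : Vec n → ℝ}
    (hg : LipschitzOnWith (L t) g (P.X t)) (hgc : ConvexOn ℝ (P.X t) g) :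
    (restrictTo (P.X t) fun z => (g z : EReal)) ∈ P.regular L t := by
  refine ⟨⟨fun z => ?_, ?_⟩, isConvex_restrictTo hgc, ?_, g, fun z hz => restrictTo_of_mem hz, hg⟩
  · by_cases hz : z ∈ P.X t
    · rw [restrictTo_of_mem hz]; exact EReal.coe_ne_bot _
    · rw [restrictTo_of_notMem hz]; exact top_ne_bot
  · obtain ⟨z, hz⟩ := hP.ri_X t
    exact ⟨z, by rw [restrictTo_of_mem (intrinsicInterior_subset hz)]; exact EReal.coe_ne_top _⟩
  · ext z
    by_cases hz : z ∈ P.X t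
    · simp [dom, restrictTo_of_mem hz, hz]
    · simp [dom, restrictTo_of_notMem hz, hz]

/-- Along a convergent subsequence of optimal trajectories, the limits of the approximations
agree with the value functions. -/
theorem LinearConvex.limit_eq_of_tendsto (hP : P.LinearConvex) (hsel : P.IsSelection L sel)
    {x₀ : Vec n} (hmem : ∀ k t, x k t ∈ P.X t)
    (hx : ∀ k, P.IsOptimalTrajectory (approx sel x (k + 1)) x₀ (x (k + 1)))
    {w : ℕ → Fin (T + 1) → Vec n → ℝ}
    (hw : ∀ k t, approx sel x (k + 1) t = restrictTo (P.X t) fun y => (w k t y : EReal))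
    {v g : Fin (T + 1) → Vec n → ℝ} (hv : ∀ t, ∀ z ∈ P.X t, P.V t z = (v t z : EReal))
    (hgL : ∀ t, LipschitzOnWith (L t) (g t) (P.X t))
    (hgu : ∀ t, TendstoUniformlyOn (fun k => w k t) (g t) atTop (P.X t))
    (hgv : ∀ t, ∀ z ∈ P.X t, g t z ≤ v t z)
    {σ : ℕ → ℕ} (hσ : StrictMono σ) (t : Fin (T + 1)) {z : Vec n}
    (hz : Tendsto (fun j => x (σ j) t) atTop (𝓝 z)) : z ∈ P.X t ∧ g t z = v t z := by
  choose u hu humin hus using fun k => (hx k).2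
  -- The first term is dropped since `σ 0` may be `0`, and the initial draw is not an optimal
  -- trajectory.
  obtain ⟨τ₀, hτ₀, hστ₀⟩ : ∃ τ : ℕ → ℕ, StrictMono τ ∧ ∀ j, σ (j + 1) = τ j + 1 := by
    have h1 : ∀ j, 1 ≤ σ (j + 1) := fun j => (Nat.le_add_left 1 j).trans (hσ.id_le (j + 1))
    refine ⟨fun j => σ (j + 1) - 1, fun i j hij => ?_, fun j => (Nat.sub_add_cancel (h1 j)).symm⟩
    exact Nat.sub_lt_sub_right (h1 i) (hσ (by omega))
  have hcomp : IsCompact ((Set.univ.pi P.X) ×ˢ (Set.univ.pi P.U)) :=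
    (isCompact_univ_pi hP.compact_X).prod (isCompact_univ_pi hP.compact_U)
  obtain ⟨⟨xs, us⟩, ⟨hxs, hus'⟩, τ₁, hτ₁, hlim⟩ :=
    hcomp.tendsto_subseq (x := fun j => (x (τ₀ j + 1), u (τ₀ j)))
      fun j => ⟨fun t _ => hmem _ t, fun t _ => hu _ t⟩
  set k : ℕ → ℕ := fun j => τ₀ (τ₁ j) with hk
  have hkt : Tendsto k atTop atTop := (hτ₀.comp hτ₁).tendsto_atTop
  have hkt1 : Tendsto (fun j => k j + 1) atTop atTop := (tendsto_add_atTop_nat 1).comp hkt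
  have hxlim : ∀ t, Tendsto (fun j => x (k j + 1) t) atTop (𝓝 (xs t)) := fun t =>
    (((continuous_apply t).comp continuous_fst).tendsto (xs, us)).comp hlim
  have hulim : ∀ t, Tendsto (fun j => u (k j) t) atTop (𝓝 (us t)) := fun t =>
    (((continuous_apply t).comp continuous_snd).tendsto (xs, us)).comp hlim
  have hwlim : ∀ t, Tendsto (fun j => w (k j) t (x (k j + 1) t)) atTop (𝓝 (g t (xs t))) := fun t =>
    tendsto_apply_of_tendstoUniformlyOn (hgu t) (hgL t).continuousOn hkt (fun j => hmem _ t)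
      (hxs t trivial) (hxlim t)
  -- The trajectory `x (k j + 1)` is optimal for `w (k j)` and produces the cuts entering `w (k j +
  -- 1)`; both have the same limit along it.
  have hwlim1 : ∀ t, Tendsto (fun j => w (k j + 1) t (x (k j + 1) t)) atTop (𝓝 (g t (xs t))) :=
    fun t => tendsto_apply_of_tendstoUniformlyOn (hgu t) (hgL t).continuousOn hkt1
      (fun j => hmem _ t) (hxs t trivial) (hxlim t)
  have key : ∀ s, v s (xs s) ≤ g s (xs s) := by
    intro s
    induction s using Fin.reverseInduction with
    | last =>
      obtain ⟨C, p, hp, hpL⟩ := hP.lipschitz_ψ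
      have hvp : ∀ y ∈ P.X (Fin.last T), v (Fin.last T) y = p y := fun y hy => by
        have := hv _ y hy
        rw [V_last, restrictTo_of_mem hy, hp y hy] at this
        exact_mod_cast this.symm
      rw [hvp _ (hxs _ trivial)]
      refine le_of_tendsto_of_tendsto' ((hpL.continuousOn _ (hxs _ trivial)).tendsto.comp
        (tendsto_nhdsWithin_iff.2 ⟨hxlim _, Eventually.of_forall fun j => hmem _ _⟩))
        (hwlim1 _) fun j => ?_
      have := hP.V_last_le_approx hsel (k j + 1) fun i _ => hmem i
      rw [hw, restrictTo_of_mem (hmem _ _), hv _ _ (hmem _ _), EReal.coe_le_coe_iff,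
        hvp _ (hmem _ _)] at this
      exact this
    | cast s ih =>
      obtain ⟨γ, C, hc, hγ, -⟩ := hP.exists_stageCost s
      have hnext : xs s.succ = P.f s (xs s.castSucc) (us s) := by
        refine tendsto_nhds_unique (hxlim s.succ) ?_
        simp only [fun j => hus (k j) s]
        exact ((continuous_f s).tendsto (xs s.castSucc, us s)).comp
          ((hxlim s.castSucc).prodMk_nhds (hulim s))
      -- The limits `g` satisfy along the limit trajectory the reverse of the Bellman inequality
      -- `hB` for the value functions.
      have hle : γ (xs s.castSucc, us s) + g s.succ (xs s.succ) ≤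
          g s.castSucc (xs s.castSucc) := by
        have hγlim : Tendsto (fun j => γ (x (k j + 1) s.castSucc, u (k j) s)) atTop
            (𝓝 (γ (xs s.castSucc, us s))) :=
          (hγ.continuousOn (xs s.castSucc, us s) ⟨hxs _ trivial, hus' _ trivial⟩).tendsto.comp
            (tendsto_nhdsWithin_iff.2 ⟨(hxlim s.castSucc).prodMk_nhds (hulim s),
              Eventually.of_forall fun j => ⟨hmem _ _, hu _ _⟩⟩)
        refine le_of_tendsto_of_tendsto' (hγlim.add (hwlim s.succ)) (hwlim1 _) fun j => ?_
        have := hP.bellmanAt_le_approx hsel (k j + 1) (fun i _ => hmem i) s (humin (k j) s)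
        rw [bellmanAt, hc _ (hmem _ _) _ (hu _ _), ← hus, hw, hw, restrictTo_of_mem (hmem _ _),
          restrictTo_of_mem (hmem _ _)] at this
        exact_mod_cast this
      have hB : P.V s.castSucc (xs s.castSucc) ≤
          P.bellmanAt s (P.V s.succ) (xs s.castSucc) (us s) := by
        rw [V_castSucc, restrictTo_of_mem (hxs _ trivial)]
        exact iInf₂_le (us s) (hus' s trivial)
      rw [bellmanAt, hc _ (hxs _ trivial) _ (hus' _ trivial), ← hnext, hv _ _ (hxs _ trivial),
        hv _ _ (hxs _ trivial)] at hB
      have hB' : v s.castSucc (xs s.castSucc) ≤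
          γ (xs s.castSucc, us s) + v s.succ (xs s.succ) := by exact_mod_cast hB
      linarith
  have hzx : z = xs t := by
    refine tendsto_nhds_unique (hz.comp ((tendsto_add_atTop_nat 1).comp hτ₁.tendsto_atTop)) ?_
    refine (hxlim t).congr fun j => ?_
    simp only [Function.comp_apply, hστ₀, hk]
  rw [hzx]
  exact ⟨hxs t trivial, le_antisymm (hgv t _ (hxs t trivial)) (key t)⟩

/-- The convergence of Tropical Dynamic Programming along one run. -/
theorem LinearConvex.exists_limit (hP : P.LinearConvex) (hsel : P.IsSelection L sel)
    {x₀ : Vec n} (hmem : ∀ k t, x k t ∈ P.X t)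
    (hx : ∀ k, P.IsOptimalTrajectory (approx sel x (k + 1)) x₀ (x (k + 1))) :
    ∃ Vstar : Fin (T + 1) → Vec n → EReal, ∀ t,
      Vstar t ∈ P.regular L t ∧
      (∀ K : Set (Vec n), IsCompact K → K ⊆ dom (P.V t) →
        ConvergesUniformlyOn (fun k => approx sel x k t) (Vstar t) K) ∧
      ∀ (σ : ℕ → ℕ) (z : Vec n), StrictMono σ → Tendsto (fun j => x (σ j) t) atTop (𝓝 z) →
        Vstar t z = P.V t z := by
  choose w hwL hwc hw using fun k t =>
    hP.exists_approx_eq hsel k (fun j _ => hmem j) t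
  have hle : ∀ k t, approx sel x k t ≤ P.V t := fun k t =>
    (hP.tdpSets_spec hsel k (fun j _ => hmem j) t).2
  -- Finiteness from below comes from the first approximation, a finite minorant on `X t`.
  have hv : ∀ t, ∀ z ∈ P.X t, P.V t z = ((P.V t z).toReal : EReal) := fun t z hz => by
    refine (EReal.coe_toReal (hP.V_lt_top t z hz).ne fun hbot => ?_).symm
    have := hle 1 t z
    rw [hw 0 t, restrictTo_of_mem hz, hbot, le_bot_iff] at this
    exact EReal.coe_ne_bot _ this
  have hwv : ∀ t k, ∀ z ∈ P.X t, w k t z ≤ (P.V t z).toReal := fun t k z hz => by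
    have := hle (k + 1) t z
    rw [hw, restrictTo_of_mem hz, hv t z hz] at this
    exact EReal.coe_le_coe_iff.1 this
  have hmono : ∀ t, ∀ z ∈ P.X t, Monotone fun k => w k t z := fun t z hz i j hij => by
    have := approx_monotone (sel := sel) (x := x) t (Nat.succ_le_succ hij) z
    simp only [Nat.succ_eq_add_one, hw, restrictTo_of_mem hz] at this
    exact_mod_cast this
  choose g hgL hgc hgu hgv using fun t => exists_limit_of_monotone_lipschitz (hP.compact_X t)
    (hP.convex_X t) (fun k => hwL k t) (fun k => hwc k t) (hmono t) (hwv t)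
  refine ⟨fun t => restrictTo (P.X t) fun z => (g t z : EReal), fun t =>
    ⟨hP.restrictTo_mem_regular (hgL t) (hgc t), fun K _ hK => ?_, fun σ z hσ hz => ?_⟩⟩
  · rw [hP.dom_V] at hK
    -- The shift is due to `w k` representing the approximation of index `k + 1`; that of index `0`
    -- is `⊥`.
    refine ⟨fun k => w (k - 1) t, g t, ?_, fun z hz => restrictTo_of_mem (hK hz), ?_⟩
    · filter_upwards [eventually_ge_atTop 1] with k hk z hz
      obtain ⟨k, rfl⟩ := Nat.exists_eq_add_of_le' hk
      rw [hw, restrictTo_of_mem (hK hz), Nat.add_sub_cancel]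
    · intro U hU
      exact (tendsto_sub_atTop_nat 1).eventually ((hgu t).mono hK U hU)
  · obtain ⟨h1, h2⟩ := hP.limit_eq_of_tendsto hsel hmem hx hw hv hgL hgu hgv hσ t hz
    dsimp only
    rw [restrictTo_of_mem h1, h2, ← hv t z h1]

end Problem

end SDDP

end

theorem mainTheorem2 {n m T : ℕ} (P : SDDP.Problem n m T) (hP : P.LinearConvex)
    {Ω : Type*} [MeasurableSpace Ω] (Pr : Measure Ω) [IsProbabilityMeasure Pr] :
    (P.StrictRecourse →
      ∃ (L : Fin (T + 1) → ℝ≥0)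
        (sel : Fin (T + 1) → Set (SDDP.Vec n → EReal) → SDDP.Vec n → SDDP.Vec n → EReal),
        P.IsSelection L sel) ∧
    ∀ (L : Fin (T + 1) → ℝ≥0)
      (sel : Fin (T + 1) → Set (SDDP.Vec n → EReal) → SDDP.Vec n → SDDP.Vec n → EReal)
      (_ : P.IsSelection L sel)
      (x₀ : SDDP.Vec n) (_ : x₀ ∈ P.X 0)
      (K₀ : Fin (T + 1) → Set (SDDP.Vec n)) (_ : ∀ t, IsCompact (K₀ t))
      (_ : ∀ t, K₀ t ⊆ SDDP.dom (P.V t))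
      (μ₀ : Measure (Fin (T + 1) → SDDP.Vec n)) (_ : ∀ᵐ x ∂μ₀, ∀ t, x t ∈ K₀ t)
      (draw traj : ℕ → Ω → Fin (T + 1) → SDDP.Vec n)
      (_ : SDDP.IsDraws Pr μ₀ (fun k ω => SDDP.trialSets K₀ (fun j => traj j ω) k) draw)
      (_ : ∀ᵐ ω ∂Pr, ∀ k, 1 ≤ k →
        P.IsOptimalTrajectory (SDDP.approx sel (fun j => draw j ω) k) x₀ (traj k ω)),
      (∀ ω t, Monotone fun k => SDDP.approx sel (fun j => draw j ω) k t) ∧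
      ∀ᵐ ω ∂Pr,
        (∀ k t, SDDP.approx sel (fun j => draw j ω) k t ≤ P.V t) ∧
        ∃ Vstar : Fin (T + 1) → SDDP.Vec n → EReal, ∀ t,
          Vstar t ∈ P.regular L t ∧
          (∀ K : Set (SDDP.Vec n), IsCompact K → K ⊆ SDDP.dom (P.V t) →
            SDDP.ConvergesUniformlyOn (fun k => SDDP.approx sel (fun j => draw j ω) k t)
              (Vstar t) K) ∧
          ∀ x ∈ SDDP.outerLimit (fun k => SDDP.trialSets K₀ (fun j => traj j ω) k t),
            Vstar t x = P.V t x := by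
  refine ⟨hP.exists_isSelection, fun L sel hsel x₀ hx₀ K₀ _ hK₀ μ₀ hμ₀ draw traj hdraw htraj =>
    ⟨fun ω t => SDDP.approx_monotone t, ?_⟩⟩
  rw [← hdraw.law_zero] at hμ₀
  filter_upwards [hdraw.ae_eq_traj, htraj, ae_of_ae_map (hdraw.measurable 0).aemeasurable hμ₀]
    with ω heq htr h0
  have hopt : ∀ k, P.IsOptimalTrajectory (SDDP.approx sel (fun j => draw j ω) (k + 1)) x₀
      (draw (k + 1) ω) := fun k => by
    rw [heq k]
    exact htr (k + 1) (Nat.le_add_left 1 k)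
  have hmem : ∀ k t, draw k ω t ∈ P.X t :=
    hP.points_mem hsel hx₀ (fun t => by rw [← hP.dom_V]; exact hK₀ t (h0 t)) hopt
  refine ⟨fun k t => (hP.tdpSets_spec hsel k (fun j _ => hmem j) t).2, ?_⟩
  obtain ⟨Vstar, hV⟩ := hP.exists_limit hsel hmem hopt
  refine ⟨Vstar, fun t => ⟨(hV t).1, (hV t).2.1, ?_⟩⟩
  rintro z ⟨σ, y, hσ, hy, hyz⟩
  -- Dropping one term makes all indices positive, where the trial sets are singletons that coincide
  -- with the draws.
  have hσ' : StrictMono fun j => σ (j + 1) := fun i j hij => hσ (by omega)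
  refine (hV t).2.2 _ z hσ' ((hyz.comp (tendsto_add_atTop_nat 1)).congr fun j => ?_)
  obtain ⟨k, hk⟩ := Nat.exists_eq_add_of_le' ((Nat.le_add_left 1 j).trans (hσ.id_le (j + 1)))
  have := hy (j + 1)
  rw [hk] at this
  change _ = draw (σ (j + 1)) ω t
  rw [hk, heq]
  exact this
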